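/- **Theorem.** Let $\zeta$ be real (the case of main interest is $\zeta<1$), let $\mu>-1$ be real, let $\alpha\ge 1$ be an integer, and for $t>0$ let $$w(x)=w(x;t)=(1-\zeta H(x-t))\,(x-t)^{\alpha}x^{\mu}e^{-x},\qquad x>0,$$ where $H(y)=1$ for $y>0$ and $H(y)=0$ otherwise. Fix an integer $n\ge 0$ and an open set $J\subseteq(0,\infty)$ such that for every $t\in J$ there are polynomials $p_0,\dots,p_n$ (depending on $t$) with complex coefficients, $\deg p_k=k$ and $\int_0^\infty p_i(x)p_j(x)w(x)\,dx=\delta_{ij}$ for $0\le i,j\le n$; for each $t\in J$ choose such polynomials. Let $\gamma_k$ be the leading coefficient of $p_k$, and put $a_k=\gamma_{k-1}/\gamma_k$ for $k\ge1$, $a_0=0$, and $b_k=\int_0^\infty x\,p_k(x)^2w(x)\,dx$ (the coefficients of the recurrence $a_{k+1}p_{k+1}=(x-b_k)p_k-a_kp_{k-1}$). Define $$R_n=\alpha\int_0^\infty\frac{w(y)p_n(y)^2}{y-t}\,dy,\qquad r_n=\alpha\,a_n\int_0^\infty\frac{w(y)p_n(y)p_{n-1}(y)}{y-t}\,dy\quad(r_0=0),$$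 $$\theta_n=b_n-2n-1-\alpha-\mu-t,\qquad \kappa_n=\Big(n+\frac{\mu}{2}\Big)t+a_n^2-\sum_{i=0}^{n-1}b_i .$$ (i) $R_n$ and $r_n$ are differentiable functions of $t\in J$. With $'=d/dt$, at every $t\in J$ $$tR_n'=2r_n-\alpha+R_n\,(tR_n+2n+\alpha+\mu-t),$$ and at every $t\in J$ with $R_n\ne 0,1$ $$t r_n'=\frac{1-2R_n}{R_n(1-R_n)}\,r_n^2-n(n+\mu)\frac{R_n}{1-R_n}+(2n+\alpha+\mu)r_n+\frac{(2n+\mu)r_n}{R_n-1}-\frac{\alpha r_n}{R_n}.$$ (ii) At every $t\in J$, $$R_n=\frac{t+\theta_n}{t},\qquad r_n=\frac{\kappa_n}{t}-\Big(n+\frac{\mu}{2}\Big).$$ (iii) For arbitrary functions $\theta,\kappa:\mathbb R\to\mathbb C$ and $t>0$, the pair $R=(t+\theta)/t$, $r=\kappa/t-(n+\mu/2)$ is differentiable at $t$ and satisfies the system in (i) there (with $R,r$ in place of $R_n,r_n$) if and only if the pair $\theta,\kappa$ is differentiable at $t$ and satisfies there the isomonodromy system $$t\theta'=2\kappa+(2n+\alpha+1+\mu+t+\theta)\,\theta,$$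 $$t\kappa'=\Big(\frac1{\theta+t}+\frac1\theta\Big)\kappa^2+\Big(2n+\alpha+\mu+1-(2n+\alpha+\mu)\frac{t}{\theta+t}\Big)\kappa-\Big(n^2+\big(n+\tfrac{\mu}{2}\big)(\alpha+\mu)\Big)t-\frac{\mu^2t^2}{4\theta}+\Big(n+\frac{\mu}{2}\Big)\Big(n+\alpha+\frac{\mu}{2}\Big)\frac{t^2}{\theta+t}.$$ Here the second equation of either system is required only where its denominators do not vanish ($R\ne0,1$, respectively $\theta\neq 0,-t$). -/

import Mathlib

open MeasureTheory Set Polynomial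

noncomputable section

namespace LadderPV

/-- The discontinuous semi-classical weight
`w(x) = (1 - ζ H(x - t)) (x - t)^α x^μ e^{-x}` on the half line `x > 0`,
where `H(y) = 1` for `y > 0` and `H(y) = 0` otherwise. -/
def weight (ζ : ℝ) (α : ℕ) (μ t x : ℝ) : ℝ :=
  (1 - ζ * (if 0 < x - t then 1 else 0)) * (x - t) ^ α * x ^ μ * Real.exp (-x)

/-- The (bilinear, not sesquilinear) form `⟨f, g⟩ = ∫_0^∞ f(x) g(x) w(x) dx`. -/
def form (w : ℝ → ℝ) (f g : ℂ[X]) : ℂ :=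
  ∫ x in Ioi (0 : ℝ), f.eval (x : ℂ) * g.eval (x : ℂ) * (w x : ℂ)

/-- `p_0, …, p_N` are orthonormal polynomials for `w`: `p_k` has degree `k` and
`⟨p_i, p_j⟩ = δ_{ij}`. Complex coefficients are allowed because the weight changes sign when
`α` is odd, so that some of the normalisation constants may be imaginary. The polynomials
are determined by these requirements up to the sign of each `p_k`. -/
structure IsOrthonormalSystem (w : ℝ → ℝ) (N : ℕ) (p : ℕ → ℂ[X]) : Prop where
  natDegree_eq : ∀ k ≤ N, (p k).natDegree = k
  form_eq : ∀ i ≤ N, ∀ j ≤ N, form w (p i) (p j) = if i = j then 1 else 0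

/-- The coefficient `a_n` of the three term recurrence
`a_{n+1} p_{n+1} = (x - b_n) p_n - a_n p_{n-1}`, that is `a_n = γ_{n-1} / γ_n` with `γ_k` the
leading coefficient of `p_k`; `a_0 = 0`. -/
def recA (p : ℕ → ℂ[X]) : ℕ → ℂ
  | 0 => 0
  | n + 1 => (p n).leadingCoeff / (p (n + 1)).leadingCoeff

/-- The coefficient `b_n` of the three term recurrence, that is `b_n = ⟨x p_n, p_n⟩`. -/
def recB (w : ℝ → ℝ) (p : ℕ → ℂ[X]) (n : ℕ) : ℂ :=
  form w (X * p n) (p n)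

/-- `R_n = α ∫_0^∞ w(y) p_n(y)^2 / (y - t) dy`. -/
def ladderR (ζ : ℝ) (α : ℕ) (μ t : ℝ) (p : ℕ → ℂ[X]) (n : ℕ) : ℂ :=
  (α : ℂ) * ∫ y in Ioi (0 : ℝ),
    (weight ζ α μ t y : ℂ) * (p n).eval (y : ℂ) ^ 2 / ((y : ℂ) - (t : ℂ))

/-- `r_n = α a_n ∫_0^∞ w(y) p_n(y) p_{n-1}(y) / (y - t) dy`, with `r_0 = 0` (as `p_{-1} = 0`). -/
def ladderr (ζ : ℝ) (α : ℕ) (μ t : ℝ) (p : ℕ → ℂ[X]) : ℕ → ℂ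
  | 0 => 0
  | n + 1 => (α : ℂ) * recA p (n + 1) * ∫ y in Ioi (0 : ℝ),
      (weight ζ α μ t y : ℂ) * (p (n + 1)).eval (y : ℂ) * (p n).eval (y : ℂ)
        / ((y : ℂ) - (t : ℂ))

/-- `θ_n = b_n - 2n - 1 - α - μ - t`. -/
def isoTheta (ζ : ℝ) (α : ℕ) (μ t : ℝ) (p : ℕ → ℂ[X]) (n : ℕ) : ℂ :=
  recB (weight ζ α μ t) p n - 2 * n - 1 - α - μ - t

/-- `κ_n = (n + μ/2) t + a_n^2 - ∑_{i < n} b_i`. -/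
def isoKappa (ζ : ℝ) (α : ℕ) (μ t : ℝ) (p : ℕ → ℂ[X]) (n : ℕ) : ℂ :=
  (n + μ / 2) * t + recA p n ^ 2 - ∑ i ∈ Finset.range n, recB (weight ζ α μ t) p i

/-- The ladder-operator system for two functions `R`, `r` of `t`, at the point `t`. The
second equation is rational in `R` and is imposed where its denominators do not vanish. -/
structure LadderSystemAt (n α : ℕ) (μ : ℝ) (R r : ℝ → ℂ) (t : ℝ) : Prop where
  differentiableAt_R : DifferentiableAt ℝ R t
  differentiableAt_r : DifferentiableAt ℝ r t
  eq_R : (t : ℂ) * deriv R t = 2 * r t - α + R t * (t * R t + 2 * n + α + μ - t)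
  eq_r : R t ≠ 0 → R t ≠ 1 →
    (t : ℂ) * deriv r t =
      (1 - 2 * R t) / (R t * (1 - R t)) * r t ^ 2 - n * (n + μ) * (R t / (1 - R t))
        + (2 * n + α + μ) * r t + (2 * n + μ) * r t / (R t - 1) - α * r t / R t

/-- The isomonodromy system for two functions `θ`, `κ` of `t`, at the point `t`. The
second equation is rational in `θ` and is imposed where its denominators do not vanish. -/
structure IsomonodromySystemAt (n α : ℕ) (μ : ℝ) (θ κ : ℝ → ℂ) (t : ℝ) : Prop where
  differentiableAt_θ : DifferentiableAt ℝ θ t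
  differentiableAt_κ : DifferentiableAt ℝ κ t
  eq_θ : (t : ℂ) * deriv θ t = 2 * κ t + (2 * n + α + 1 + μ + t + θ t) * θ t
  eq_κ : θ t ≠ 0 → θ t + t ≠ 0 →
    (t : ℂ) * deriv κ t =
      (1 / (θ t + t) + 1 / θ t) * κ t ^ 2
        + (2 * n + α + μ + 1 - (2 * n + α + μ) * (t / (θ t + t))) * κ t
        - (n ^ 2 + (n + μ / 2) * (α + μ)) * t - μ ^ 2 * t ^ 2 / (4 * θ t)
        + (n + μ / 2) * (n + α + μ / 2) * (t ^ 2 / (θ t + t))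

end LadderPV

end

/-! Everything is expressed through monic orthogonal polynomials `P k`, which do not see the sign
choices in `p`. With α replaced by α + 1, let L be the functional of the weight and W the one with
exponent α, so that W((X - t)F) = L(F). Write h_n = L(P_n²); then R_n = (α+1)W(P_n²)/h_n and r_n =
(α+1)W(P_n P_{n-1})/h_{n-1}.

Integration by parts (`weightFunctional_pearson`) has no boundary term at the jump because (x -
t)^(α+1) vanishes there. Applied to P_n² and P_n P_{n-1} it gives part (ii): tR_n is b_n up to a
constant, and t r_n is a_n² plus the subleading coefficient of P_n.

Differentiating orthogonality in t gives h_n' = -R_n h_n and shows that the subleading coefficient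
has derivative r_n. Hence the equation for R_n, and t r_n' = a_n²(R_{n-1} - R_n).

The unknowns a_n² and R_{n-1} are eliminated by two quadratic relations, one for each singular point
t and 0 of the weight. Both are instances of `quadratic_relation`, a determinant argument resting on
the fact that P_n and P_{n-1} have no common root. Part (iii) is a change of variables. -/

namespace LadderPV

/-! ### Orthogonal polynomials for an abstract linear functional. -/

/-- `P_0, …, P_n` are monic orthogonal polynomials with nonzero norms for the linear
functional `L`. -/
structure IsMonicOrthogonal {K : Type*} [Field K] (L : K[X] →ₗ[K] K) (n : ℕ) (P : ℕ → K[X]) :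
    Prop where
  monic : ∀ k ≤ n, (P k).Monic
  natDegree_eq : ∀ k ≤ n, (P k).natDegree = k
  orthogonal : ∀ i ≤ n, ∀ j < i, L (P i * P j) = 0
  norm_ne_zero : ∀ k ≤ n, L (P k * P k) ≠ 0

namespace IsMonicOrthogonal

variable {K : Type*} [Field K] {L : K[X] →ₗ[K] K} {n : ℕ} {P : ℕ → K[X]}

theorem mono (H : IsMonicOrthogonal L n P) {m : ℕ} (hm : m ≤ n) : IsMonicOrthogonal L m P where
  monic k hk := H.monic k (hk.trans hm)
  natDegree_eq k hk := H.natDegree_eq k (hk.trans hm)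
  orthogonal i hi := H.orthogonal i (hi.trans hm)
  norm_ne_zero k hk := H.norm_ne_zero k (hk.trans hm)

theorem degree_eq (H : IsMonicOrthogonal L n P) {k : ℕ} (hk : k ≤ n) : (P k).degree = k := by
  rw [degree_eq_natDegree (H.monic k hk).ne_zero, H.natDegree_eq k hk]

theorem coeff_self (H : IsMonicOrthogonal L n P) {k : ℕ} (hk : k ≤ n) : (P k).coeff k = 1 := by
  have := H.monic k hk
  rwa [Monic, leadingCoeff, H.natDegree_eq k hk] at this

theorem degree_sub_C_mul_lt (H : IsMonicOrthogonal L n P) {k : ℕ} (hk : k ≤ n) {q : K[X]}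
    (hq : q.degree ≤ k) : (q - C (q.coeff k) * P k).degree < k := by
  rw [degree_lt_iff_coeff_zero]
  intro m hm
  rcases hm.eq_or_lt with rfl | hm
  · simp [H.coeff_self hk]
  · have h1 : q.coeff m = 0 := coeff_eq_zero_of_degree_lt (hq.trans_lt (by exact_mod_cast hm))
    have h2 : (P k).coeff m = 0 :=
      coeff_eq_zero_of_degree_lt (by rw [H.degree_eq hk]; exact_mod_cast hm)
    simp [h1, h2]

theorem eq_zero_of_degree_lt (H : IsMonicOrthogonal L n P) {k : ℕ} (hk : k ≤ n) {q : K[X]}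
    (hq : q.degree < k) : L (P k * q) = 0 := by
  have key : ∀ d ≤ k, ∀ q : K[X], q.degree < d → L (P k * q) = 0 := by
    intro d
    induction d with
    | zero =>
      intro _ q hq
      have : q = 0 := by
        rw [← degree_eq_bot]
        by_contra h
        exact absurd hq (not_lt.2 (by simpa using zero_le_degree_iff.2 (degree_ne_bot.1 h)))
      simp [this]
    | succ d ih =>
      intro hd q hq
      have hq' : q.degree ≤ d := by
        rw [degree_le_iff_coeff_zero]
        intro m hm
        exact coeff_eq_zero_of_degree_lt (hq.trans_le (by exact_mod_cast hm))
      have h1 := ih (by omega) _ (H.degree_sub_C_mul_lt (k := d) (by omega) hq')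
      have h2 := H.orthogonal k hk d (by omega)
      have h3 : P k * q = P k * (q - C (q.coeff d) * P d) + q.coeff d • (P k * P d) := by
        rw [smul_eq_C_mul]; ring
      rw [h3, map_add, h1, map_smul, h2]
      simp
  exact key k le_rfl q hq

theorem apply_mul (H : IsMonicOrthogonal L n P) {k : ℕ} (hk : k ≤ n) {q : K[X]}
    (hq : q.degree ≤ k) : L (P k * q) = q.coeff k * L (P k * P k) := by
  have h3 : P k * q = P k * (q - C (q.coeff k) * P k) + q.coeff k • (P k * P k) := by
    rw [smul_eq_C_mul]; ring
  rw [h3, map_add, H.eq_zero_of_degree_lt hk (H.degree_sub_C_mul_lt hk hq), map_smul]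
  simp

/-- Pairing a nonzero q with the `P j` of the same degree returns its leading coefficient times a
nonzero norm. -/
theorem eq_zero_of_forall (H : IsMonicOrthogonal L n P) {k : ℕ} (hk : k ≤ n) {q : K[X]}
    (hq : q.degree < k) (h0 : ∀ j < k, L (P j * q) = 0) : q = 0 := by
  by_contra hne
  have hd := degree_eq_natDegree hne
  have hlt : q.natDegree < k := by rw [hd] at hq; exact_mod_cast hq
  have := h0 _ hlt
  rw [H.apply_mul (by omega) hd.le] at this
  rcases mul_eq_zero.1 this with h | h
  · exact hne (leadingCoeff_eq_zero.1 h)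
  · exact H.norm_ne_zero _ (by omega) h

/-- The Gram-Schmidt formula. -/
theorem gramSchmidt (H : IsMonicOrthogonal L n P) {k : ℕ} (hk : k ≤ n) :
    P k = X ^ k - ∑ j ∈ Finset.range k, C (L (P j * X ^ k) / L (P j * P j)) * P j := by
  rw [← sub_eq_zero]
  refine H.eq_zero_of_forall hk ?_ ?_
  · have h1 : (P k - X ^ k).degree < (k : WithBot ℕ) := by
      have := Polynomial.degree_sub_lt_left (p := P k) (q := X ^ k) (by rw [H.degree_eq hk, degree_X_pow])
        (H.monic k hk).ne_zero (by rw [(H.monic k hk).leadingCoeff, leadingCoeff_X_pow])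
      rwa [H.degree_eq hk] at this
    have h2 : (∑ j ∈ Finset.range k, C (L (P j * X ^ k) / L (P j * P j)) * P j).degree < (k : WithBot ℕ) := by
      refine (degree_sum_le _ _).trans_lt ?_
      rw [Finset.sup_lt_iff (by exact WithBot.bot_lt_coe k)]
      intro j hj
      have hj := Finset.mem_range.1 hj
      refine lt_of_le_of_lt (b := (P j).degree) ?_ (by
        rw [H.degree_eq (by omega)]; exact_mod_cast hj)
      rw [← smul_eq_C_mul]
      exact degree_smul_le _ _
    rw [sub_sub_eq_add_sub, add_sub_right_comm]
    exact (degree_add_le _ _).trans_lt (max_lt h1 h2)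
  · intro i hi
    have h0 : L (P i * P k) = 0 := by rw [mul_comm]; exact H.orthogonal k hk i hi
    have h1 : ∀ j ∈ Finset.range k, j ≠ i →
        L (P i * (C (L (P j * X ^ k) / L (P j * P j)) * P j)) = 0 := by
      intro j hj hji
      have hj := Finset.mem_range.1 hj
      have : P i * (C (L (P j * X ^ k) / L (P j * P j)) * P j)
          = (L (P j * X ^ k) / L (P j * P j)) • (P i * P j) := by
        rw [smul_eq_C_mul]; ring
      rw [this, map_smul]
      rcases lt_or_gt_of_ne hji with h | h
      · simp [H.orthogonal i (by omega) j h]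
      · rw [mul_comm (P i), H.orthogonal j (by omega) i h]; simp
    have h2 : P i * (C (L (P i * X ^ k) / L (P i * P i)) * P i)
          = (L (P i * X ^ k) / L (P i * P i)) • (P i * P i) := by
        rw [smul_eq_C_mul]; ring
    rw [mul_sub, mul_sub, Finset.mul_sum, map_sub, map_sub, map_sum,
      Finset.sum_eq_single_of_mem i (Finset.mem_range.2 hi) h1, h2, map_smul, h0, smul_eq_mul,
      div_mul_cancel₀ _ (H.norm_ne_zero i (by omega))]
    ring

/-- Consecutive orthogonal polynomials have no common root. -/
theorem not_common_root (H : IsMonicOrthogonal L (n + 1) P) (z : K) :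
    ¬ ((P (n + 1)).eval z = 0 ∧ (P n).eval z = 0) := by
  rintro ⟨h1, h2⟩
  obtain ⟨A, hA⟩ := dvd_iff_isRoot.2 h1
  obtain ⟨B, hB⟩ := dvd_iff_isRoot.2 h2
  have hAm : A.Monic := (monic_X_sub_C z).of_mul_monic_left (hA ▸ H.monic _ le_rfl)
  have hBm : B.Monic := (monic_X_sub_C z).of_mul_monic_left (hB ▸ H.monic n (by omega))
  have hAd : A.natDegree = n := by
    have := H.natDegree_eq (n + 1) le_rfl
    rw [hA, (monic_X_sub_C z).natDegree_mul hAm, natDegree_X_sub_C] at this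
    omega
  have hBd : B.natDegree < n + 1 := by
    have := H.natDegree_eq n (by omega)
    rw [hB, (monic_X_sub_C z).natDegree_mul hBm, natDegree_X_sub_C] at this
    omega
  -- The product P_{n+1} B = P_n A is evaluated in two ways: zero by orthogonality on the left, the
  -- norm of P_n on the right.
  have e1 : L (P (n + 1) * B) = 0 :=
    H.eq_zero_of_degree_lt le_rfl
      (by rw [degree_eq_natDegree hBm.ne_zero]; exact_mod_cast hBd)
  have e2 : L (P n * A) = L (P n * P n) := by
    rw [H.apply_mul (by omega) (by rw [degree_eq_natDegree hAm.ne_zero, hAd])]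
    have : A.coeff n = 1 := by rw [← hAd]; exact hAm
    rw [this, one_mul]
  have e3 : P (n + 1) * B = P n * A := by rw [hA, hB]; ring
  rw [e3, e2] at e1
  exact H.norm_ne_zero n (by omega) e1

/-- If `(X - z) W = c L`, then the values of `W` on products of two consecutive orthogonal
polynomials satisfy a quadratic relation. -/
theorem quadratic_relation (H : IsMonicOrthogonal L (n + 1) P) (W : K[X] →ₗ[K] K) (z c : K)
    (hW : ∀ F, W ((X - C z) * F) = c * L F) :
    W (P (n + 1) * P n) * (W (P (n + 1) * P n) - c * L (P n * P n))
      = W (P (n + 1) * P (n + 1)) * W (P n * P n) := by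
  set a := (P (n + 1)).eval z with ha
  set b := (P n).eval z with hb
  -- This combination is divisible by X - z, so W of its multiples reduces to L, where orthogonality
  -- applies.
  have hroot : (C a * P n - C b * P (n + 1)).IsRoot z := by
    simp [IsRoot, ← ha, ← hb, mul_comm]
  obtain ⟨q, hq⟩ := dvd_iff_isRoot.2 hroot
  have hqdeg : q.degree ≤ n := by
    by_cases hq0 : q = 0
    · simp [hq0]
    have h1 : (C a * P n - C b * P (n + 1)).natDegree ≤ n + 1 := by
      refine (natDegree_sub_le _ _).trans (max_le ?_ ?_)
      · exact (natDegree_C_mul_le _ _).trans ((H.natDegree_eq n (by omega)).le.trans (by omega))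
      · exact (natDegree_C_mul_le _ _).trans (H.natDegree_eq _ le_rfl).le
    rw [hq, natDegree_mul (X_sub_C_ne_zero z) hq0, natDegree_X_sub_C] at h1
    rw [degree_eq_natDegree hq0]
    exact_mod_cast (by omega : q.natDegree ≤ n)
  have hqc : q.coeff n = -b := by
    have h1 := congrArg (fun p => p.coeff (n + 1)) hq
    have h2 : (P n).coeff (n + 1) = 0 := coeff_eq_zero_of_natDegree_lt
      (by rw [H.natDegree_eq n (by omega)]; omega)
    have h3 : q.coeff (n + 1) = 0 := coeff_eq_zero_of_degree_lt
      (hqdeg.trans_lt (by exact_mod_cast Nat.lt_succ_self n))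
    simp only [coeff_sub, coeff_C_mul, h2, H.coeff_self le_rfl, sub_mul, coeff_X_mul, h3] at h1
    linear_combination -h1
  have e1 : a * W (P (n + 1) * P n) - b * W (P (n + 1) * P (n + 1)) = 0 := by
    have : a • (P (n + 1) * P n) - b • (P (n + 1) * P (n + 1))
        = (X - C z) * (P (n + 1) * q) := by
      rw [smul_eq_C_mul, smul_eq_C_mul]; linear_combination P (n + 1) * hq
    have h := congrArg W this
    rw [hW, H.eq_zero_of_degree_lt le_rfl (hqdeg.trans_lt (by exact_mod_cast Nat.lt_succ_self n))]
      at h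
    simpa using h
  have e2 : a * W (P n * P n) - b * W (P (n + 1) * P n) = c * (-b * L (P n * P n)) := by
    have : a • (P n * P n) - b • (P (n + 1) * P n)
        = (X - C z) * (P n * q) := by
      rw [smul_eq_C_mul, smul_eq_C_mul]; linear_combination P n * hq
    have h := congrArg W this
    rw [hW, H.apply_mul (by omega) hqdeg, hqc] at h
    simpa using h
  -- `e1` and `e2` form a homogeneous linear system with solution (a, -b), nonzero by
  -- `not_common_root`; the claim is that its determinant vanishes.
  by_cases hb0 : b = 0
  · have ha0 : a ≠ 0 := fun h => H.not_common_root z ⟨h, hb0⟩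
    apply mul_left_cancel₀ ha0
    linear_combination (W (P (n + 1) * P n) - c * L (P n * P n)) * e1
      - W (P (n + 1) * P (n + 1)) * e2
  · apply mul_left_cancel₀ hb0
    linear_combination W (P n * P n) * e1 - W (P (n + 1) * P n) * e2

/-- Only the degree n coefficient of X P_n - P_{n+1} survives the pairing with P_n. `nextCoeff` is
used because it is 0 at n = 0, where a truncated index n - 1 would read the leading coefficient. -/
theorem apply_X_mul (H : IsMonicOrthogonal L (n + 1) P) :
    L (P n * (X * P n)) = L (P n * P n) * ((P n).nextCoeff - (P (n + 1)).coeff n) := by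
  have h1 : (X * P n - P (n + 1)).degree ≤ (n : WithBot ℕ) := by
    rw [degree_le_iff_coeff_zero]
    intro m hm
    have hm : n < m := by exact_mod_cast hm
    obtain ⟨m, rfl⟩ : ∃ k, m = k + 1 := ⟨m - 1, by omega⟩
    rw [coeff_sub, coeff_X_mul]
    rcases (by omega : n = m ∨ n < m) with rfl | h
    · rw [H.coeff_self (by omega), H.coeff_self le_rfl, sub_self]
    · rw [coeff_eq_zero_of_natDegree_lt (by rw [H.natDegree_eq n (by omega)]; omega),
        coeff_eq_zero_of_natDegree_lt (by rw [H.natDegree_eq _ le_rfl]; omega), sub_self]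
  have h2 : P n * (X * P n) = P n * (X * P n - P (n + 1)) + P (n + 1) * P n := by ring
  rw [h2, map_add, H.apply_mul (by omega) h1, H.orthogonal _ le_rfl n (by omega), coeff_sub]
  have h3 : (X * P n).coeff n = (P n).nextCoeff := by
    rw [nextCoeff, H.natDegree_eq n (by omega)]
    cases n with
    | zero => simp
    | succ m => simp
  rw [h3]; ring

/-- The subleading coefficient is minus the sum of the diagonal recurrence coefficients. -/
theorem nextCoeff_eq_neg_sum (H : IsMonicOrthogonal L n P) :
    (P n).nextCoeff = -∑ i ∈ Finset.range n, L (P i * (X * P i)) / L (P i * P i) := by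
  induction n with
  | zero => simp [nextCoeff, H.natDegree_eq 0 le_rfl]
  | succ n ih =>
    have h0 := H.norm_ne_zero n (by omega)
    have h1 : (P (n + 1)).nextCoeff = (P (n + 1)).coeff n := by
      rw [nextCoeff, H.natDegree_eq _ le_rfl]; simp
    rw [Finset.sum_range_succ, H.apply_X_mul, mul_div_cancel_left₀ _ h0, neg_add,
      ← ih (H.mono (by omega)), h1]
    ring

/-- The Euler operator acts on `P n` as multiplication by `n` up to lower order terms. -/
theorem degree_euler_sub_lt (H : IsMonicOrthogonal L n P) :
    (X * derivative (P n) - C (n : K) * P n).degree < (n : WithBot ℕ) := by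
  rw [degree_lt_iff_coeff_zero]
  intro m hm
  have key : (X * derivative (P n)).coeff m = m * (P n).coeff m := by
    cases m with
    | zero => simp
    | succ m => rw [coeff_X_mul, coeff_derivative]; push_cast; ring
  rw [coeff_sub, key, coeff_C_mul]
  rcases hm.eq_or_lt with rfl | hm
  · ring
  · rw [coeff_eq_zero_of_natDegree_lt (by rw [H.natDegree_eq n le_rfl]; omega)]; ring

theorem apply_euler (H : IsMonicOrthogonal L n P) :
    L (P n * (X * derivative (P n))) = n * L (P n * P n) := by
  have : P n * (X * derivative (P n))
      = P n * (X * derivative (P n) - C (n : K) * P n) + (n : K) • (P n * P n) := by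
    rw [smul_eq_C_mul]; ring
  rw [this, map_add, H.eq_zero_of_degree_lt le_rfl H.degree_euler_sub_lt, map_smul]
  simp

/-- Subtracting (n+1)P_{n+1}, which P_n does not see, leaves the degree n coefficient (n - (n+1))
times the subleading one. -/
theorem apply_euler_prev (H : IsMonicOrthogonal L (n + 1) P) :
    L (P n * (X * derivative (P (n + 1)))) = -(P (n + 1)).coeff n * L (P n * P n) := by
  have h1 : (X * derivative (P (n + 1)) - C ((n + 1 : ℕ) : K) * P (n + 1)).degree ≤ (n : WithBot ℕ) := by
    have := H.degree_euler_sub_lt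
    rw [degree_le_iff_coeff_zero]
    intro m hm
    exact coeff_eq_zero_of_degree_lt (this.trans_le (by exact_mod_cast hm))
  have h2 : P n * (X * derivative (P (n + 1)))
      = P n * (X * derivative (P (n + 1)) - C ((n + 1 : ℕ) : K) * P (n + 1))
        + ((n + 1 : ℕ) : K) • (P (n + 1) * P n) := by
    rw [smul_eq_C_mul]; ring
  have key : (X * derivative (P (n + 1))).coeff n = n * (P (n + 1)).coeff n := by
    cases n with
    | zero => simp
    | succ m => rw [coeff_X_mul, coeff_derivative]; push_cast; ring
  rw [h2, map_add, map_smul, H.orthogonal _ le_rfl n (by omega), H.apply_mul (by omega) h1,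
    coeff_sub, coeff_C_mul, key, smul_zero]
  push_cast
  ring

end IsMonicOrthogonal
-- Moments of the jump weight.
open Filter Topology

theorem integrableOn_pow_mul_rpow_mul_exp {μ : ℝ} (hμ : -1 < μ) (m : ℕ) :
    IntegrableOn (fun x : ℝ => x ^ m * (x ^ μ * Real.exp (-x))) (Ioi 0) := by
  have h := Real.GammaIntegral_convergent (s := m + μ + 1)
    (by have : (0 : ℝ) ≤ m := Nat.cast_nonneg m
        linarith)
  refine h.congr_fun (fun x hx => ?_) measurableSet_Ioi
  have hx : 0 < x := hx
  simp only
  rw [add_sub_cancel_right, Real.rpow_add hx, Real.rpow_natCast]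
  ring

/-- The tail `∫_t^∞ x^(m+μ) e^{-x} dx` of the Gamma integral. -/
noncomputable def gammaTail (μ : ℝ) (m : ℕ) (t : ℝ) : ℝ :=
  ∫ x in Ioi t, x ^ m * (x ^ μ * Real.exp (-x))

/-- Integrate the derivative of x^(m+1+μ) e^{-x}. The exponent is positive, so t = 0 is allowed. -/
theorem gammaTail_succ {μ : ℝ} (hμ : -1 < μ) (m : ℕ) {t : ℝ} (ht : 0 ≤ t) :
    gammaTail μ (m + 1) t = (m + 1 + μ) * gammaTail μ m t
      + t ^ (m + 1) * (t ^ μ * Real.exp (-t)) := by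
  have hpos : 0 < (m : ℝ) + 1 + μ := by
    have : (0 : ℝ) ≤ m := Nat.cast_nonneg m
    linarith
  have hint : ∀ k, IntegrableOn (fun x : ℝ => x ^ k * (x ^ μ * Real.exp (-x))) (Ioi t) :=
    fun k => (integrableOn_pow_mul_rpow_mul_exp hμ k).mono_set (Ioi_subset_Ioi ht)
  have key := integral_Ioi_of_hasDerivAt_of_tendsto (a := t) (m := 0)
    (f := fun x : ℝ => x ^ ((m : ℝ) + 1 + μ) * Real.exp (-x))
    (f' := fun x : ℝ => ((m : ℝ) + 1 + μ) * (x ^ m * (x ^ μ * Real.exp (-x)))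
      - x ^ (m + 1) * (x ^ μ * Real.exp (-x))) ?_ ?_ ?_ ?_
  · rw [integral_sub ((hint m).const_mul _) (hint (m + 1)), integral_const_mul] at key
    have e : t ^ ((m : ℝ) + 1 + μ) = t ^ (m + 1) * t ^ μ := by
      rcases ht.eq_or_lt with rfl | ht
      · rw [Real.zero_rpow hpos.ne']; simp
      · rw [Real.rpow_add ht]; norm_cast
    rw [e] at key
    unfold gammaTail
    linarith
  · exact ((Real.continuous_rpow_const hpos.le).mul
      (Real.continuous_exp.comp continuous_neg)).continuousWithinAt
  · intro x hx
    have hx : 0 < x := ht.trans_lt hx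
    have h1 := (Real.hasDerivAt_rpow_const (x := x) (p := (m : ℝ) + 1 + μ) (Or.inl hx.ne')).mul
      ((hasDerivAt_neg x).exp)
    refine h1.congr_deriv ?_
    have e1 : x ^ ((m : ℝ) + 1 + μ - 1) = x ^ m * x ^ μ := by
      rw [show (m : ℝ) + 1 + μ - 1 = m + μ by ring, Real.rpow_add hx, Real.rpow_natCast]
    have e2 : x ^ ((m : ℝ) + 1 + μ) = x ^ (m + 1) * x ^ μ := by
      rw [Real.rpow_add hx]; norm_cast
    rw [e1, e2]; ring
  · exact ((hint m).const_mul _).sub (hint (m + 1))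
  · simpa using tendsto_rpow_mul_exp_neg_mul_atTop_nhds_zero ((m : ℝ) + 1 + μ) 1 one_pos

theorem hasDerivAt_gammaTail {μ : ℝ} (hμ : -1 < μ) (m : ℕ) {t : ℝ} (ht : 0 < t) :
    HasDerivAt (gammaTail μ m) (-(t ^ m * (t ^ μ * Real.exp (-t)))) t := by
  have hint := integrableOn_pow_mul_rpow_mul_exp hμ m
  have hii : IntervalIntegrable (fun x : ℝ => x ^ m * (x ^ μ * Real.exp (-x))) volume 0 t :=
    (intervalIntegrable_iff_integrableOn_Ioc_of_le ht.le).2 (hint.mono_set Ioc_subset_Ioi_self)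
  have hcont : ContinuousOn (fun x : ℝ => x ^ m * (x ^ μ * Real.exp (-x))) (Ioi 0) := by
    refine (continuous_pow m).continuousOn.mul (ContinuousOn.mul ?_ (by fun_prop))
    exact fun x hx => (Real.continuousAt_rpow_const x μ (Or.inl (ne_of_gt hx))).continuousWithinAt
  have h1 := intervalIntegral.integral_hasDerivAt_right hii
    (hcont.stronglyMeasurableAtFilter isOpen_Ioi t ht) (hcont.continuousAt (Ioi_mem_nhds ht))
  have h2 := (hasDerivAt_const t (gammaTail μ m 0)).sub h1
  rw [zero_sub] at h2
  refine h2.congr_of_eventuallyEq ?_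
  filter_upwards [Ioi_mem_nhds ht] with s hs
  have hs : 0 < s := hs
  simp only [Pi.sub_apply, gammaTail]
  rw [intervalIntegral.integral_of_le hs.le, ← Ioc_union_Ioi_eq_Ioi hs.le,
    setIntegral_union (Ioc_disjoint_Ioi le_rfl) measurableSet_Ioi
      (hint.mono_set Ioc_subset_Ioi_self) (hint.mono_set (Ioi_subset_Ioi hs.le))]
  ring

/-- The moments of `(1 - ζ H(x - t)) x^μ e^{-x}` on the half line. -/
noncomputable def jumpMoment (ζ μ : ℝ) (m : ℕ) (t : ℝ) : ℝ :=
  gammaTail μ m 0 - ζ * gammaTail μ m t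

theorem jumpMoment_succ {μ : ℝ} (ζ : ℝ) (hμ : -1 < μ) (m : ℕ) {t : ℝ} (ht : 0 < t) :
    jumpMoment ζ μ (m + 1) t = (m + 1 + μ) * jumpMoment ζ μ m t
      - ζ * (t ^ (m + 1) * (t ^ μ * Real.exp (-t))) := by
  have h0 := gammaTail_succ hμ m le_rfl
  rw [jumpMoment, h0, gammaTail_succ hμ m ht.le, jumpMoment, zero_pow (by omega)]
  ring

theorem hasDerivAt_jumpMoment {μ : ℝ} (ζ : ℝ) (hμ : -1 < μ) (m : ℕ) {t : ℝ} (ht : 0 < t) :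
    HasDerivAt (jumpMoment ζ μ m) (ζ * (t ^ m * (t ^ μ * Real.exp (-t)))) t := by
  have := (hasDerivAt_const t (gammaTail μ m 0)).sub ((hasDerivAt_gammaTail hμ m ht).const_mul ζ)
  exact this.congr_deriv (by ring)

theorem jump_eq (ζ t x y : ℝ) : (1 - ζ * (if 0 < x - t then 1 else 0)) * y
    = y - ζ * (Ioi t).indicator (fun _ => y) x := by
  by_cases h : t < x
  · simp [indicator, h]; ring
  · simp [indicator, h]

theorem integrableOn_jump {μ : ℝ} (ζ : ℝ) (hμ : -1 < μ) (m : ℕ) (t : ℝ) :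
    IntegrableOn (fun x : ℝ => (1 - ζ * (if 0 < x - t then 1 else 0)) *
      (x ^ m * (x ^ μ * Real.exp (-x)))) (Ioi 0) := by
  have h := integrableOn_pow_mul_rpow_mul_exp hμ m
  have h2 := h.sub ((h.indicator (measurableSet_Ioi (a := t))).const_mul ζ)
  refine h2.congr (Eventually.of_forall fun x => ?_)
  simp only [Pi.sub_apply]
  rw [jump_eq]
  simp [indicator]

theorem integral_jump {μ : ℝ} (ζ : ℝ) (hμ : -1 < μ) (m : ℕ) {t : ℝ} (ht : 0 < t) :
    ∫ x in Ioi (0 : ℝ), (1 - ζ * (if 0 < x - t then 1 else 0)) *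
      (x ^ m * (x ^ μ * Real.exp (-x))) = jumpMoment ζ μ m t := by
  have h := integrableOn_pow_mul_rpow_mul_exp hμ m
  have e : ∀ x : ℝ, (1 - ζ * (if 0 < x - t then 1 else 0)) * (x ^ m * (x ^ μ * Real.exp (-x)))
      = x ^ m * (x ^ μ * Real.exp (-x)) - ζ * (Ioi t).indicator
        (fun x => x ^ m * (x ^ μ * Real.exp (-x))) x := by
    intro x; rw [jump_eq]; simp [indicator]
  simp_rw [e]
  rw [integral_sub h ((h.indicator measurableSet_Ioi).const_mul ζ), integral_const_mul,
    setIntegral_indicator measurableSet_Ioi, Ioi_inter_Ioi, sup_eq_right.2 ht.le]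
  rfl

/-! ### Moment functionals and integration by parts. -/

/-- The functional `F ↦ ∫_0^∞ (1 - ζ H(x - t)) F(x) x^μ e^{-x} dx`. -/
noncomputable def jumpFunctional (ζ μ t : ℝ) : ℂ[X] →ₗ[ℂ] ℂ :=
  Polynomial.lsum fun m => (jumpMoment ζ μ m t : ℂ) • LinearMap.id

theorem jumpFunctional_monomial (ζ μ t : ℝ) (m : ℕ) (a : ℂ) :
    jumpFunctional ζ μ t (monomial m a) = a * jumpMoment ζ μ m t := by
  simp [jumpFunctional, mul_comm]

theorem jumpFunctional_eq_sum (ζ μ t : ℝ) (F : ℂ[X]) {N : ℕ} (hN : F.natDegree ≤ N) :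
    jumpFunctional ζ μ t F = ∑ i ∈ Finset.range (N + 1), F.coeff i * jumpMoment ζ μ i t := by
  conv_lhs => rw [F.as_sum_range' (N + 1) (by omega)]
  simp [jumpFunctional_monomial]

theorem integral_eval_mul_jump {μ : ℝ} (ζ : ℝ) (hμ : -1 < μ) {t : ℝ} (ht : 0 < t) (F : ℂ[X]) :
    ∫ x in Ioi (0 : ℝ), F.eval (x : ℂ) *
      (((1 - ζ * (if 0 < x - t then 1 else 0)) * (x ^ μ * Real.exp (-x)) : ℝ) : ℂ)
      = jumpFunctional ζ μ t F := by
  have e : ∀ x : ℝ, F.eval (x : ℂ) *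
      (((1 - ζ * (if 0 < x - t then 1 else 0)) * (x ^ μ * Real.exp (-x)) : ℝ) : ℂ)
      = ∑ i ∈ Finset.range (F.natDegree + 1), F.coeff i *
        (((1 - ζ * (if 0 < x - t then 1 else 0)) * (x ^ i * (x ^ μ * Real.exp (-x))) : ℝ) : ℂ) := by
    intro x
    rw [eval_eq_sum_range, Finset.sum_mul]
    refine Finset.sum_congr rfl fun i _ => ?_
    push_cast
    ring
  simp_rw [e]
  rw [integral_finsetSum, jumpFunctional_eq_sum _ _ _ F le_rfl]
  · refine Finset.sum_congr rfl fun i _ => ?_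
    rw [integral_const_mul, integral_complex_ofReal, integral_jump ζ hμ i ht]
  · intro i _
    exact (integrableOn_jump ζ hμ i t).ofReal.const_mul _

/-- The functional of the weight `w(x; t)`. -/
noncomputable def weightFunctional (ζ : ℝ) (α : ℕ) (μ t : ℝ) : ℂ[X] →ₗ[ℂ] ℂ :=
  jumpFunctional ζ μ t ∘ₗ LinearMap.mulLeft ℂ ((X - C (t : ℂ)) ^ α)

theorem weightFunctional_apply (ζ : ℝ) (α : ℕ) (μ t : ℝ) (F : ℂ[X]) :
    weightFunctional ζ α μ t F = jumpFunctional ζ μ t ((X - C (t : ℂ)) ^ α * F) := rfl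

theorem integral_eval_mul_weight {μ : ℝ} (ζ : ℝ) (hμ : -1 < μ) (α : ℕ) {t : ℝ} (ht : 0 < t)
    (F : ℂ[X]) : ∫ x in Ioi (0 : ℝ), F.eval (x : ℂ) * (weight ζ α μ t x : ℂ)
      = weightFunctional ζ α μ t F := by
  rw [weightFunctional_apply, ← integral_eval_mul_jump ζ hμ ht]
  congr 1
  ext x
  simp only [weight, eval_mul, eval_pow, eval_sub, eval_X, eval_C]
  push_cast
  ring

/-- Division by x - t lowers the exponent. The equality is only almost everywhere, since the
quotient takes the default value 0 at x = t. -/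
theorem integral_weight_div {μ : ℝ} (ζ : ℝ) (hμ : -1 < μ) (α : ℕ) {t : ℝ} (ht : 0 < t)
    (F : ℂ[X]) : ∫ x in Ioi (0 : ℝ), (weight ζ (α + 1) μ t x : ℂ) * F.eval (x : ℂ)
      / ((x : ℂ) - (t : ℂ)) = weightFunctional ζ α μ t F := by
  rw [← integral_eval_mul_weight ζ hμ α ht]
  refine integral_congr_ae ?_
  have : ∀ᵐ x ∂(volume.restrict (Ioi (0 : ℝ))), x ≠ t := Measure.ae_ne _ t
  filter_upwards [this] with x hx
  have hx' : (x : ℂ) - t ≠ 0 := by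
    rw [sub_ne_zero]; exact_mod_cast hx
  rw [div_eq_iff hx']
  simp only [weight]
  push_cast
  ring

theorem form_eq_weightFunctional {μ : ℝ} (ζ : ℝ) (hμ : -1 < μ) (α : ℕ) {t : ℝ} (ht : 0 < t)
    (f g : ℂ[X]) : form (weight ζ α μ t) f g = weightFunctional ζ α μ t (f * g) := by
  rw [← integral_eval_mul_weight ζ hμ α ht]
  simp [form]

/-- Integration by parts against `(1 - ζ H(x - t)) x^(μ+1) e^{-x}`. -/
theorem jumpFunctional_pearson {μ : ℝ} (ζ : ℝ) (hμ : -1 < μ) {t : ℝ} (ht : 0 < t) (F : ℂ[X]) :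
    jumpFunctional ζ μ t ((C (μ + 1 : ℂ) - X) * F + X * derivative F)
      = ζ * t * F.eval (t : ℂ) * (t ^ μ * Real.exp (-t) : ℝ) := by
  induction F using Polynomial.induction_on' with
  | add p q hp hq =>
    rw [derivative_add, eval_add, show (C (μ + 1 : ℂ) - X) * (p + q) + X * (derivative p + derivative q)
      = ((C (μ + 1 : ℂ) - X) * p + X * derivative p)
        + ((C (μ + 1 : ℂ) - X) * q + X * derivative q) by ring, map_add, hp, hq]
    ring
  | monomial m a =>
    have e : (C (μ + 1 : ℂ) - X) * monomial m a + X * derivative (monomial m a)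
        = monomial m ((m + 1 + μ) * a) - monomial (m + 1) a := by
      rw [derivative_monomial]
      cases m with
      | zero =>
        simp only [← C_mul_X_pow_eq_monomial, map_mul, map_add, map_one, map_natCast]
        simp
        ring
      | succ m =>
        simp only [← C_mul_X_pow_eq_monomial, map_mul, map_add, map_one, map_natCast]
        simp only [Nat.add_sub_cancel]
        ring
    rw [e, map_sub, jumpFunctional_monomial, jumpFunctional_monomial, jumpMoment_succ ζ hμ m ht,
      eval_monomial]
    push_cast
    ring

theorem weightFunctional_succ (ζ : ℝ) (α : ℕ) (μ t : ℝ) (F : ℂ[X]) :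
    weightFunctional ζ (α + 1) μ t F = weightFunctional ζ α μ t ((X - C (t : ℂ)) * F) := by
  simp only [weightFunctional_apply]
  congr 1
  ring

/-- Integration by parts against the weight. -/
theorem weightFunctional_pearson {μ : ℝ} (ζ : ℝ) (hμ : -1 < μ) (α : ℕ) {t : ℝ} (ht : 0 < t)
    (F : ℂ[X]) : (α + 1) * t * weightFunctional ζ α μ t F
      = weightFunctional ζ (α + 1) μ t ((X - C (α + 1 + μ + 1 : ℂ)) * F - X * derivative F) := by
  -- The factor (X - t)^(α+1) kills the boundary term at t.
  have h := jumpFunctional_pearson ζ hμ ht ((X - C (t : ℂ)) ^ (α + 1) * F)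
  have e : (C (μ + 1 : ℂ) - X) * ((X - C (t : ℂ)) ^ (α + 1) * F)
        + X * derivative ((X - C (t : ℂ)) ^ (α + 1) * F)
      = ((α + 1 : ℂ) * t) • ((X - C (t : ℂ)) ^ α * F)
        - (X - C (t : ℂ)) ^ (α + 1) * ((X - C (α + 1 + μ + 1 : ℂ)) * F - X * derivative F) := by
    rw [derivative_mul, derivative_X_sub_C_pow, smul_eq_C_mul]
    simp only [map_add, map_mul, map_one, map_natCast, Nat.add_sub_cancel, Nat.cast_add,
      Nat.cast_one]
    ring
  rw [e, map_sub, map_smul, ← weightFunctional_apply, ← weightFunctional_apply] at h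
  simp only [eval_mul, eval_pow, eval_sub, eval_X, eval_C, sub_self, ne_eq, Nat.add_eq_zero_iff,
    one_ne_zero, and_false, not_false_eq_true, zero_pow, zero_mul, mul_zero, smul_eq_mul] at h
  linear_combination h

/-! ### Differentiating polynomial families and functionals in t. -/

/-- A family of polynomials of bounded degree whose coefficients are differentiable at `t`, the
derivatives being the coefficients of `D`. -/
structure HasPolyDerivAt (P : ℝ → ℂ[X]) (D : ℂ[X]) (t : ℝ) : Prop where
  coeff : ∀ i, HasDerivAt (fun s => (P s).coeff i) (D.coeff i) t
  bounded : ∃ N, ∀ᶠ s in 𝓝 t, (P s).natDegree ≤ N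

namespace HasPolyDerivAt

variable {P Q : ℝ → ℂ[X]} {D E : ℂ[X]} {t : ℝ}

theorem const (F : ℂ[X]) (t : ℝ) : HasPolyDerivAt (fun _ => F) 0 t where
  coeff i := by simpa using hasDerivAt_const t (F.coeff i)
  bounded := ⟨F.natDegree, Eventually.of_forall fun _ => le_rfl⟩

theorem C {f : ℝ → ℂ} {f' : ℂ} (hf : HasDerivAt f f' t) :
    HasPolyDerivAt (fun s => Polynomial.C (f s)) (Polynomial.C f') t where
  coeff i := by
    cases i with
    | zero => simpa using hf
    | succ i => simpa [coeff_C] using hasDerivAt_const t (0 : ℂ)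
  bounded := ⟨0, Eventually.of_forall fun _ => by simp⟩

theorem add (hP : HasPolyDerivAt P D t) (hQ : HasPolyDerivAt Q E t) :
    HasPolyDerivAt (fun s => P s + Q s) (D + E) t where
  coeff i := by simpa using (hP.coeff i).fun_add (hQ.coeff i)
  bounded := by
    obtain ⟨N, hN⟩ := hP.bounded
    obtain ⟨M, hM⟩ := hQ.bounded
    refine ⟨max N M, ?_⟩
    filter_upwards [hN, hM] with s h1 h2
    exact (natDegree_add_le _ _).trans (max_le_max h1 h2)

theorem sub (hP : HasPolyDerivAt P D t) (hQ : HasPolyDerivAt Q E t) :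
    HasPolyDerivAt (fun s => P s - Q s) (D - E) t where
  coeff i := by simpa using (hP.coeff i).fun_sub (hQ.coeff i)
  bounded := by
    obtain ⟨N, hN⟩ := hP.bounded
    obtain ⟨M, hM⟩ := hQ.bounded
    refine ⟨max N M, ?_⟩
    filter_upwards [hN, hM] with s h1 h2
    exact (natDegree_sub_le _ _).trans (max_le_max h1 h2)

theorem mul (hP : HasPolyDerivAt P D t) (hQ : HasPolyDerivAt Q E t) :
    HasPolyDerivAt (fun s => P s * Q s) (D * Q t + P t * E) t where
  coeff i := by
    simp only [coeff_add, coeff_mul]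
    rw [← Finset.sum_add_distrib]
    exact HasDerivAt.fun_sum fun x _ => (hP.coeff x.1).mul (hQ.coeff x.2)
  bounded := by
    obtain ⟨N, hN⟩ := hP.bounded
    obtain ⟨M, hM⟩ := hQ.bounded
    refine ⟨N + M, ?_⟩
    filter_upwards [hN, hM] with s h1 h2
    exact natDegree_mul_le.trans (add_le_add h1 h2)

theorem sum {ι : Type*} {P : ι → ℝ → ℂ[X]} {D : ι → ℂ[X]} {I : Finset ι}
    (h : ∀ i ∈ I, HasPolyDerivAt (P i) (D i) t) :
    HasPolyDerivAt (fun s => ∑ i ∈ I, P i s) (∑ i ∈ I, D i) t := by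
  classical
  induction I using Finset.induction_on with
  | empty => simpa using const 0 t
  | insert a I ha ih =>
    simp only [Finset.sum_insert ha]
    exact (h a (by simp)).add (ih fun i hi => h i (by simp [hi]))

theorem pow (hP : HasPolyDerivAt P D t) (k : ℕ) :
    HasPolyDerivAt (fun s => P s ^ (k + 1)) ((k + 1 : ℂ[X]) * P t ^ k * D) t := by
  induction k with
  | zero => simpa using hP
  | succ k ih =>
    have := ih.mul hP
    have e : (((k + 1 : ℕ) : ℂ[X]) + 1) * P t ^ (k + 1) * D
        = (k + 1 : ℂ[X]) * P t ^ k * D * P t + P t ^ (k + 1) * D := by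
      push_cast
      ring
    rw [e]
    exact this

theorem congr_of_eventuallyEq (hP : HasPolyDerivAt P D t) (h : Q =ᶠ[𝓝 t] P) :
    HasPolyDerivAt Q D t where
  coeff i := (hP.coeff i).congr_of_eventuallyEq (h.mono fun s hs => by simp only [hs])
  bounded := by
    obtain ⟨N, hN⟩ := hP.bounded
    refine ⟨N, ?_⟩
    filter_upwards [hN, h] with s h1 h2
    rwa [h2]

/-- Differentiation of a functional `∫ (1 - ζ H(x - t)) F(x) x^μ e^{-x} dx` in `t`. -/
theorem jumpFunctional {ζ μ : ℝ} (hμ : -1 < μ) (ht : 0 < t) (hP : HasPolyDerivAt P D t) :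
    HasDerivAt (fun s => LadderPV.jumpFunctional ζ μ s (P s))
      (LadderPV.jumpFunctional ζ μ t D
        + ζ * (P t).eval (t : ℂ) * (t ^ μ * Real.exp (-t) : ℝ)) t := by
  obtain ⟨N, hN⟩ := hP.bounded
  have hD : D.natDegree ≤ N := by
    rw [natDegree_le_iff_coeff_eq_zero]
    intro i hi
    refine (hP.coeff i).unique ((hasDerivAt_const t (0 : ℂ)).congr_of_eventuallyEq ?_)
    filter_upwards [hN] with s hs
    exact coeff_eq_zero_of_natDegree_lt (hs.trans_lt hi)
  -- The uniform degree bound turns the functional into one fixed finite sum near t.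
  have h1 : HasDerivAt
      (fun s => ∑ i ∈ Finset.range (N + 1), (P s).coeff i * (jumpMoment ζ μ i s : ℂ)) _ t :=
    HasDerivAt.fun_sum fun i _ =>
      (hP.coeff i).mul ((hasDerivAt_jumpMoment ζ hμ i ht).ofReal_comp)
  have h2 : (fun s => LadderPV.jumpFunctional ζ μ s (P s)) =ᶠ[𝓝 t]
      fun s => ∑ i ∈ Finset.range (N + 1), (P s).coeff i * (jumpMoment ζ μ i s : ℂ) := by
    filter_upwards [hN] with s hs
    exact jumpFunctional_eq_sum _ _ _ _ hs
  refine (h1.congr_of_eventuallyEq h2).congr_deriv ?_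
  rw [Finset.sum_add_distrib, jumpFunctional_eq_sum _ _ _ _ hD,
    eval_eq_sum_range' (Nat.lt_succ_of_le hN.self_of_nhds), Finset.mul_sum, Finset.sum_mul]
  congr 1
  refine Finset.sum_congr rfl fun i _ => ?_
  push_cast
  ring

/-- Product rule for (X - s)^(α+1) P_s. The contribution of the moving jump contains (t - t)^(α+1) =
0; this needs a positive exponent. -/
theorem weightFunctional {ζ μ : ℝ} (hμ : -1 < μ) (α : ℕ) (ht : 0 < t)
    (hP : HasPolyDerivAt P D t) :
    HasDerivAt (fun s => LadderPV.weightFunctional ζ (α + 1) μ s (P s))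
      (LadderPV.weightFunctional ζ (α + 1) μ t D
        - (α + 1) * LadderPV.weightFunctional ζ α μ t (P t)) t := by
  have h0 : HasPolyDerivAt (fun s : ℝ => X - Polynomial.C (s : ℂ)) (0 - Polynomial.C 1) t :=
    (const X t).sub (.C ((hasDerivAt_id t).ofReal_comp))
  have h1 := ((h0.pow α).mul hP).jumpFunctional (ζ := ζ) hμ ht
  refine h1.congr_deriv ?_
  have e : ((α + 1 : ℂ[X]) * (X - Polynomial.C (t : ℂ)) ^ α * (0 - Polynomial.C 1)) * P t
        + (X - Polynomial.C (t : ℂ)) ^ (α + 1) * D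
      = (X - Polynomial.C (t : ℂ)) ^ (α + 1) * D
        - ((α : ℂ) + 1) • ((X - Polynomial.C (t : ℂ)) ^ α * P t) := by
    rw [smul_eq_C_mul]
    simp only [map_add, map_one, map_natCast]
    ring
  rw [e, map_sub, map_smul, weightFunctional_apply, weightFunctional_apply]
  simp

end HasPolyDerivAt
-- Identities at a fixed t.
section Algebraic

variable {ζ μ t : ℝ} {α n : ℕ} {P : ℕ → ℂ[X]}

/-- `R_n` for the exponent `α + 1`, in terms of the monic orthogonal polynomials. -/
noncomputable def monicR (ζ : ℝ) (α : ℕ) (μ t : ℝ) (P : ℕ → ℂ[X]) (n : ℕ) : ℂ :=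
  (α + 1) * weightFunctional ζ α μ t (P n * P n) / weightFunctional ζ (α + 1) μ t (P n * P n)

/-- `r_n` for the exponent `α + 1`, in terms of the monic orthogonal polynomials. -/
noncomputable def monicr (ζ : ℝ) (α : ℕ) (μ t : ℝ) (P : ℕ → ℂ[X]) : ℕ → ℂ
  | 0 => 0
  | n + 1 => (α + 1) * weightFunctional ζ α μ t (P (n + 1) * P n)
      / weightFunctional ζ (α + 1) μ t (P n * P n)

/-- `b_n` for the exponent `α + 1`, in terms of the monic orthogonal polynomials. -/
noncomputable def monicB (ζ : ℝ) (α : ℕ) (μ t : ℝ) (P : ℕ → ℂ[X]) (n : ℕ) : ℂ :=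
  weightFunctional ζ (α + 1) μ t (P n * (X * P n)) / weightFunctional ζ (α + 1) μ t (P n * P n)

/-- Integration by parts with F = P_n²; the Euler operator contributes the 2n. -/
theorem mul_monicR (hμ : -1 < μ) (ht : 0 < t)
    (H : IsMonicOrthogonal (weightFunctional ζ (α + 1) μ t) n P) :
    t * monicR ζ α μ t P n = monicB ζ α μ t P n - (2 * n + 1 + (α + 1) + μ) := by
  have h0 := H.norm_ne_zero n le_rfl
  have h := weightFunctional_pearson ζ hμ α ht (P n * P n)
  have e : (X - C (α + 1 + μ + 1 : ℂ)) * (P n * P n) - X * derivative (P n * P n)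
      = P n * (X * P n) - (α + 1 + μ + 1 : ℂ) • (P n * P n)
        - (2 : ℂ) • (P n * (X * derivative (P n))) := by
    rw [derivative_mul, smul_eq_C_mul, smul_eq_C_mul, map_ofNat]; ring
  rw [e, map_sub, map_sub, map_smul, map_smul, H.apply_euler] at h
  simp only [smul_eq_mul] at h
  rw [monicR, monicB]
  field_simp
  linear_combination h

/-- Integration by parts with F = P_{n+1} P_n: X P_n yields the norm of P_{n+1}, and X P_{n+1}' the
subleading coefficient. -/
theorem mul_monicr (hμ : -1 < μ) (ht : 0 < t)
    (H : IsMonicOrthogonal (weightFunctional ζ (α + 1) μ t) (n + 1) P) :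
    t * monicr ζ α μ t P (n + 1)
      = weightFunctional ζ (α + 1) μ t (P (n + 1) * P (n + 1))
          / weightFunctional ζ (α + 1) μ t (P n * P n) + (P (n + 1)).coeff n := by
  have h0 := H.norm_ne_zero n (by omega)
  have h := weightFunctional_pearson ζ hμ α ht (P (n + 1) * P n)
  have e : (X - C (α + 1 + μ + 1 : ℂ)) * (P (n + 1) * P n) - X * derivative (P (n + 1) * P n)
      = P (n + 1) * (X * P n) - (α + 1 + μ + 1 : ℂ) • (P (n + 1) * P n)
        - P (n + 1) * (X * derivative (P n)) - P n * (X * derivative (P (n + 1))) := by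
    rw [derivative_mul, smul_eq_C_mul]; ring
  have hd : (P n).degree = n := H.degree_eq (by omega)
  have d1 : (X * P n).degree ≤ ((n + 1 : ℕ) : WithBot ℕ) := by
    rw [degree_mul, degree_X, hd, add_comm]; norm_cast
  have d2 : (X * derivative (P n)).degree < ((n + 1 : ℕ) : WithBot ℕ) := by
    have : (derivative (P n)).degree < (P n).degree :=
      degree_derivative_lt (H.monic n (by omega)).ne_zero
    rw [degree_lt_iff_coeff_zero]
    intro m hm
    obtain ⟨m, rfl⟩ : ∃ k, m = k + 1 := ⟨m - 1, by omega⟩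
    rw [coeff_X_mul]
    refine coeff_eq_zero_of_degree_lt (this.trans_le ?_)
    rw [hd]
    exact_mod_cast (by omega : n ≤ m)
  rw [e, map_sub, map_sub, map_sub, map_smul, H.apply_euler_prev,
    H.orthogonal (n + 1) le_rfl n (by omega), H.eq_zero_of_degree_lt le_rfl d2,
    H.apply_mul le_rfl d1, coeff_X_mul, H.coeff_self (by omega)] at h
  simp only [smul_zero] at h
  rw [monicr]
  field_simp
  linear_combination h

theorem apply_X_mul_deriv
    (H : IsMonicOrthogonal (weightFunctional ζ (α + 1) μ t) n P) :
    (α + 1) * weightFunctional ζ α μ t (P n * (X * P n))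
      = (α + 1 + t * monicR ζ α μ t P n)
        * weightFunctional ζ (α + 1) μ t (P n * P n) := by
  have h0 := H.norm_ne_zero n le_rfl
  have e : P n * (X * P n) = (X - C (t : ℂ)) * (P n * P n) + (t : ℂ) • (P n * P n) := by
    rw [smul_eq_C_mul]; ring
  rw [e, map_add, ← weightFunctional_succ, map_smul, monicR, smul_eq_mul]
  field_simp

/-- The relation from the singular point `x = t`. -/
theorem monic_relation_at_jump
    (H : IsMonicOrthogonal (weightFunctional ζ (α + 1) μ t) (n + 1) P) :
    monicr ζ α μ t P (n + 1) * (monicr ζ α μ t P (n + 1) - (α + 1))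
      = weightFunctional ζ (α + 1) μ t (P (n + 1) * P (n + 1))
          / weightFunctional ζ (α + 1) μ t (P n * P n)
        * monicR ζ α μ t P (n + 1) * monicR ζ α μ t P n := by
  have h0 := H.norm_ne_zero n (by omega)
  have h1 := H.norm_ne_zero (n + 1) le_rfl
  have h := H.quadratic_relation (((α : ℂ) + 1) • weightFunctional ζ α μ t) t (α + 1)
    (fun F => by rw [LinearMap.smul_apply, ← weightFunctional_succ, smul_eq_mul])
  simp only [LinearMap.smul_apply, smul_eq_mul] at h
  simp only [monicr, monicR]
  field_simp
  have hα : (α : ℂ) + 1 ≠ 0 := by exact_mod_cast α.succ_ne_zero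
  apply mul_left_cancel₀ (pow_ne_zero 2 hα)
  linear_combination h

/-- The relation from the singular point `x = 0`. -/
theorem monic_relation_at_zero (hμ : -1 < μ) (ht : 0 < t)
    (H : IsMonicOrthogonal (weightFunctional ζ (α + 1) μ t) (n + 1) P) :
    (n + 1 + monicr ζ α μ t P (n + 1)) * (n + 1 + monicr ζ α μ t P (n + 1) + μ)
      = weightFunctional ζ (α + 1) μ t (P (n + 1) * P (n + 1))
          / weightFunctional ζ (α + 1) μ t (P n * P n)
        * (1 - monicR ζ α μ t P (n + 1)) * (1 - monicR ζ α μ t P n) := by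
  have h0 := H.norm_ne_zero n (by omega)
  have h1 := H.norm_ne_zero (n + 1) le_rfl
  set L := weightFunctional ζ (α + 1) μ t with hL
  -- For μ > 0, W is μ∫ F w/x dx rewritten by parts; this form makes sense for every μ > -1, even
  -- where w/x is not integrable at 0.
  set W : ℂ[X] →ₗ[ℂ] ℂ := L - L ∘ₗ derivative - ((α : ℂ) + 1) • weightFunctional ζ α μ t with hWdef
  have hWF : ∀ F, W F = L F - L (derivative F) - (α + 1) * weightFunctional ζ α μ t F := by
    intro F; simp [hWdef]
  have hW : ∀ F, W ((X - C 0) * F) = μ * L F := by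
    intro F
    have h := weightFunctional_pearson ζ hμ α ht F
    have h2 : weightFunctional ζ α μ t (X * F) = L F + t * weightFunctional ζ α μ t F := by
      have e : X * F = (X - C (t : ℂ)) * F + (t : ℂ) • F := by rw [smul_eq_C_mul]; ring
      rw [e, map_add, ← weightFunctional_succ, map_smul, smul_eq_mul]
    have e : (X - C (α + 1 + μ + 1 : ℂ)) * F - X * derivative F
        = X * F - derivative (X * F) - (α + 1 + μ : ℂ) • F := by
      rw [derivative_mul, derivative_X, smul_eq_C_mul]
      simp only [map_add, map_one]
      ring
    rw [e, map_sub, map_sub, map_smul, smul_eq_mul, ← hL] at h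
    rw [C_0, sub_zero, hWF, h2]
    linear_combination -h
  have hder : ∀ k ≤ n + 1, L (P k * derivative (P k)) = 0 := fun k hk =>
    H.eq_zero_of_degree_lt hk
      ((degree_derivative_lt (H.monic k hk).ne_zero).trans_eq (H.degree_eq hk))
  have hdiag : ∀ k ≤ n + 1, W (P k * P k) = L (P k * P k) * (1 - monicR ζ α μ t P k) := by
    intro k hk
    have hk0 := H.norm_ne_zero k hk
    have e : derivative (P k * P k) = (2 : ℂ) • (P k * derivative (P k)) := by
      rw [derivative_mul, smul_eq_C_mul, map_ofNat]; ring
    rw [hWF, e, map_smul, hder k hk, monicR, ← hL]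
    field_simp
    simp
  have hoff : W (P (n + 1) * P n) = -(n + 1 + monicr ζ α μ t P (n + 1)) * L (P n * P n) := by
    have e : derivative (P (n + 1) * P n)
        = P n * derivative (P (n + 1)) + P (n + 1) * derivative (P n) := by
      rw [derivative_mul]; ring
    have e1 : L (P (n + 1) * derivative (P n)) = 0 := by
      refine H.eq_zero_of_degree_lt le_rfl
        ((degree_derivative_lt (H.monic n (by omega)).ne_zero).trans ?_)
      rw [H.degree_eq (by omega)]
      exact_mod_cast Nat.lt_succ_self n
    have e2 : L (P n * derivative (P (n + 1))) = (n + 1) * L (P n * P n) := by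
      rw [H.apply_mul (by omega), coeff_derivative, H.coeff_self le_rfl, one_mul]
      have := degree_derivative_lt (H.monic (n + 1) le_rfl).ne_zero
      rw [H.degree_eq le_rfl] at this
      rw [degree_le_iff_coeff_zero]
      intro m hm
      exact coeff_eq_zero_of_degree_lt (this.trans_le (by exact_mod_cast hm))
    rw [hWF, e, map_add, e1, e2, H.orthogonal _ le_rfl n (by omega), monicr, ← hL]
    field_simp
    ring
  have h := H.quadratic_relation W 0 μ hW
  rw [hoff, hdiag _ le_rfl, hdiag n (by omega)] at h
  have h3 : ((n + 1 + monicr ζ α μ t P (n + 1)) * (n + 1 + monicr ζ α μ t P (n + 1) + μ)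
      * L (P n * P n)) * L (P n * P n) = (L (P (n + 1) * P (n + 1))
        * (1 - monicR ζ α μ t P (n + 1)) * (1 - monicR ζ α μ t P n)) * L (P n * P n) := by
    linear_combination h
  have h4 := mul_right_cancel₀ h0 h3
  field_simp
  linear_combination h4

end Algebraic

/-! ### Evolution in t. -/

section Evolution

variable {ζ μ t : ℝ} {α n : ℕ} {P : ℝ → ℕ → ℂ[X]} {J : Set ℝ}

/-- No regularity in t is assumed: Gram-Schmidt determines the monic polynomials from functionals
already known to be differentiable, by induction on k. -/
theorem exists_hasPolyDerivAt (hμ : -1 < μ) (hJ : IsOpen J) (hJ0 : J ⊆ Ioi 0)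
    (H : ∀ s ∈ J, IsMonicOrthogonal (weightFunctional ζ (α + 1) μ s) n (P s)) (k : ℕ)
    (hk : k ≤ n) (ht : t ∈ J) : ∃ D, HasPolyDerivAt (fun s => P s k) D t := by
  induction k using Nat.strong_induction_on with
  | _ k ih =>
    have hcoef : ∀ j ∈ Finset.range k, ∃ D, HasPolyDerivAt (fun s =>
        C (weightFunctional ζ (α + 1) μ s (P s j * X ^ k)
          / weightFunctional ζ (α + 1) μ s (P s j * P s j)) * P s j) D t := by
      intro j hj
      have hj := Finset.mem_range.1 hj
      obtain ⟨D, hD⟩ := ih j hj (by omega)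
      have h1 := (hD.mul (.const (X ^ k) t)).weightFunctional (ζ := ζ) hμ α (hJ0 ht)
      have h2 := (hD.mul hD).weightFunctional (ζ := ζ) hμ α (hJ0 ht)
      have h3 := h1.fun_div h2 ((H t ht).norm_ne_zero j (by omega))
      exact ⟨_, (HasPolyDerivAt.C h3).mul hD⟩
    choose! D hD using hcoef
    refine ⟨_, ((HasPolyDerivAt.const (X ^ k) t).sub
      (HasPolyDerivAt.sum hD)).congr_of_eventuallyEq ?_⟩
    filter_upwards [hJ.mem_nhds ht] with s hs
    exact (H s hs).gramSchmidt hk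

theorem exists_hasPolyDerivAt_degree_lt (hμ : -1 < μ) (hJ : IsOpen J) (hJ0 : J ⊆ Ioi 0)
    (H : ∀ s ∈ J, IsMonicOrthogonal (weightFunctional ζ (α + 1) μ s) n (P s)) (k : ℕ)
    (hk : k ≤ n) (ht : t ∈ J) :
    ∃ D : ℂ[X], D.degree < (k : WithBot ℕ) ∧ HasPolyDerivAt (fun s => P s k) D t := by
  obtain ⟨D, hD⟩ := exists_hasPolyDerivAt hμ hJ hJ0 H k hk ht
  refine ⟨D, ?_, hD⟩
  rw [degree_lt_iff_coeff_zero]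
  intro m hm
  have : (fun s => (P s k).coeff m) =ᶠ[𝓝 t] fun _ => if m = k then 1 else 0 := by
    filter_upwards [hJ.mem_nhds ht] with s hs
    split_ifs with h
    · rw [h, (H s hs).coeff_self hk]
    · exact coeff_eq_zero_of_natDegree_lt (by rw [(H s hs).natDegree_eq k hk]; omega)
  exact (hD.coeff m).unique ((hasDerivAt_const t _).congr_of_eventuallyEq this)

/-- The derivative of P_k has lower degree, hence is orthogonal to P_k; only the motion of the
weight remains. -/
theorem hasDerivAt_norm (hμ : -1 < μ) (hJ : IsOpen J) (hJ0 : J ⊆ Ioi 0)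
    (H : ∀ s ∈ J, IsMonicOrthogonal (weightFunctional ζ (α + 1) μ s) n (P s)) (k : ℕ)
    (hk : k ≤ n) (ht : t ∈ J) :
    HasDerivAt (fun s => weightFunctional ζ (α + 1) μ s (P s k * P s k))
      (-(weightFunctional ζ (α + 1) μ t (P t k * P t k) * monicR ζ α μ t (P t) k)) t := by
  obtain ⟨D, hDd, hD⟩ := exists_hasPolyDerivAt_degree_lt hμ hJ hJ0 H k hk ht
  have h0 := (H t ht).norm_ne_zero k hk
  refine ((hD.mul hD).weightFunctional (ζ := ζ) hμ α (hJ0 ht)).congr_deriv ?_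
  rw [map_add, mul_comm D, (H t ht).eq_zero_of_degree_lt hk hDd, monicR]
  field_simp
  ring

/-- Differentiate the relation L(P_{n+1} P_n) = 0. -/
theorem hasDerivAt_subleading (hμ : -1 < μ) (hJ : IsOpen J) (hJ0 : J ⊆ Ioi 0)
    (H : ∀ s ∈ J, IsMonicOrthogonal (weightFunctional ζ (α + 1) μ s) (n + 1) (P s))
    (ht : t ∈ J) {D : ℂ[X]} (hDd : D.degree < ((n + 1 : ℕ) : WithBot ℕ))
    (hD : HasPolyDerivAt (fun s => P s (n + 1)) D t) :
    D.coeff n = monicr ζ α μ t (P t) (n + 1) := by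
  have h0 := (H t ht).norm_ne_zero n (by omega)
  obtain ⟨E, hEd, hE⟩ := exists_hasPolyDerivAt_degree_lt hμ hJ hJ0 H n (by omega) ht
  have h1 := (hD.mul hE).weightFunctional (ζ := ζ) hμ α (hJ0 ht)
  have h2 : (fun s => weightFunctional ζ (α + 1) μ s (P s (n + 1) * P s n)) =ᶠ[𝓝 t]
      fun _ => 0 := by
    filter_upwards [hJ.mem_nhds ht] with s hs
    exact (H s hs).orthogonal _ le_rfl n (by omega)
  have h3 := h1.unique ((hasDerivAt_const t (0 : ℂ)).congr_of_eventuallyEq h2)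
  have hD' : D.degree ≤ (n : WithBot ℕ) := by
    rw [degree_le_iff_coeff_zero]
    intro m hm
    exact coeff_eq_zero_of_degree_lt (hDd.trans_le (by exact_mod_cast hm))
  rw [map_add, mul_comm D, (H t ht).apply_mul (by omega) hD',
    (H t ht).eq_zero_of_degree_lt le_rfl (hEd.trans (by exact_mod_cast Nat.lt_succ_self n))] at h3
  rw [monicr]
  field_simp
  linear_combination h3

theorem apply_X_mul_polyDeriv (hμ : -1 < μ) (hJ : IsOpen J) (hJ0 : J ⊆ Ioi 0)
    (H : ∀ s ∈ J, IsMonicOrthogonal (weightFunctional ζ (α + 1) μ s) n (P s))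
    (ht : t ∈ J) {D : ℂ[X]} (hDd : D.degree < (n : WithBot ℕ))
    (hD : HasPolyDerivAt (fun s => P s n) D t) :
    weightFunctional ζ (α + 1) μ t (P t n * (X * D))
      = monicr ζ α μ t (P t) n * weightFunctional ζ (α + 1) μ t (P t n * P t n) := by
  have hd : (X * D).degree ≤ (n : WithBot ℕ) := by
    rw [degree_le_iff_coeff_zero]
    intro m hm
    have hm : n < m := by exact_mod_cast hm
    obtain ⟨m, rfl⟩ : ∃ k, m = k + 1 := ⟨m - 1, by omega⟩
    rw [coeff_X_mul]
    exact coeff_eq_zero_of_degree_lt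
      (hDd.trans_le (by exact_mod_cast (by omega : n ≤ m)))
  rw [(H t ht).apply_mul le_rfl hd]
  cases n with
  | zero => simp [monicr]
  | succ n => rw [coeff_X_mul, hasDerivAt_subleading hμ hJ hJ0 H ht hDd hD]

theorem hasDerivAt_monicB (hμ : -1 < μ) (hJ : IsOpen J) (hJ0 : J ⊆ Ioi 0)
    (H : ∀ s ∈ J, IsMonicOrthogonal (weightFunctional ζ (α + 1) μ s) n (P s)) (ht : t ∈ J) :
    HasDerivAt (fun s => monicB ζ α μ s (P s) n)
      (monicB ζ α μ t (P t) n * monicR ζ α μ t (P t) n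
        - (α + 1 + t * monicR ζ α μ t (P t) n) + 2 * monicr ζ α μ t (P t) n) t := by
  have h0 := (H t ht).norm_ne_zero n le_rfl
  obtain ⟨D, hDd, hD⟩ := exists_hasPolyDerivAt_degree_lt hμ hJ hJ0 H n le_rfl ht
  have h1 := (hD.mul ((HasPolyDerivAt.const X t).mul hD)).weightFunctional (ζ := ζ) hμ α (hJ0 ht)
  have h2 := h1.fun_div (hasDerivAt_norm hμ hJ hJ0 H n le_rfl ht) h0
  refine h2.congr_deriv ?_
  have e : D * (X * P t n) + P t n * (0 * P t n + X * D) = (2 : ℂ) • (P t n * (X * D)) := by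
    rw [smul_eq_C_mul, map_ofNat]; ring
  rw [e, map_smul, apply_X_mul_polyDeriv hμ hJ hJ0 H ht hDd hD,
    apply_X_mul_deriv (H t ht), monicB]
  simp only [smul_eq_mul]
  field_simp
  ring

/-- R_n is differentiated through b_n, not through its definition: the functional of exponent α may
be 0 there, and its derivative would then retain a jump term. -/
theorem hasDerivAt_monicR (hμ : -1 < μ) (hJ : IsOpen J) (hJ0 : J ⊆ Ioi 0)
    (H : ∀ s ∈ J, IsMonicOrthogonal (weightFunctional ζ (α + 1) μ s) n (P s)) (ht : t ∈ J) :
    HasDerivAt (fun s => monicR ζ α μ s (P s) n)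
      ((2 * monicr ζ α μ t (P t) n - (α + 1) + monicR ζ α μ t (P t) n
        * (t * monicR ζ α μ t (P t) n + 2 * n + (α + 1) + μ - t)) / t) t := by
  have ht0 : (t : ℂ) ≠ 0 := by exact_mod_cast (hJ0 ht : 0 < t).ne'
  have h1 := ((hasDerivAt_monicB hμ hJ hJ0 H ht).sub_const (2 * n + 1 + (α + 1) + μ : ℂ)).fun_div
    ((hasDerivAt_id t).ofReal_comp) ht0
  have h2 : (fun s => monicR ζ α μ s (P s) n) =ᶠ[𝓝 t]
      fun s => (monicB ζ α μ s (P s) n - (2 * n + 1 + (α + 1) + μ : ℂ)) / (s : ℂ) := by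
    filter_upwards [hJ.mem_nhds ht] with s hs
    have hs0 : (s : ℂ) ≠ 0 := by exact_mod_cast (hJ0 hs : 0 < s).ne'
    rw [eq_div_iff hs0, ← mul_monicR hμ (hJ0 hs) (H s hs), mul_comm]
  refine (h1.congr_of_eventuallyEq h2).congr_deriv ?_
  have h3 := mul_monicR hμ (hJ0 ht) (H t ht)
  have h4 : monicB ζ α μ t (P t) n
      = t * monicR ζ α μ t (P t) n + (2 * n + 1 + (α + 1) + μ) := by linear_combination -h3
  simp only [id, h4, Complex.ofReal_one]
  field_simp
  ring

theorem hasDerivAt_monicr (hμ : -1 < μ) (hJ : IsOpen J) (hJ0 : J ⊆ Ioi 0)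
    (H : ∀ s ∈ J, IsMonicOrthogonal (weightFunctional ζ (α + 1) μ s) (n + 1) (P s))
    (ht : t ∈ J) :
    HasDerivAt (fun s => monicr ζ α μ s (P s) (n + 1))
      (weightFunctional ζ (α + 1) μ t (P t (n + 1) * P t (n + 1))
        / weightFunctional ζ (α + 1) μ t (P t n * P t n)
        * (monicR ζ α μ t (P t) n - monicR ζ α μ t (P t) (n + 1)) / t) t := by
  have ht0 : (t : ℂ) ≠ 0 := by exact_mod_cast (hJ0 ht : 0 < t).ne'
  have h0 := (H t ht).norm_ne_zero n (by omega)
  obtain ⟨D, hDd, hD⟩ := exists_hasPolyDerivAt_degree_lt hμ hJ hJ0 H (n + 1) le_rfl ht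
  have h1 := ((hasDerivAt_norm hμ hJ hJ0 H (n + 1) le_rfl ht).fun_div
    (hasDerivAt_norm hμ hJ hJ0 H n (by omega) ht) h0).fun_add (hD.coeff n)
  have h2 := h1.fun_div ((hasDerivAt_id t).ofReal_comp) ht0
  have h3 : (fun s => monicr ζ α μ s (P s) (n + 1)) =ᶠ[𝓝 t]
      fun s => (weightFunctional ζ (α + 1) μ s (P s (n + 1) * P s (n + 1))
        / weightFunctional ζ (α + 1) μ s (P s n * P s n) + (P s (n + 1)).coeff n) / (s : ℂ) := by
    filter_upwards [hJ.mem_nhds ht] with s hs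
    have hs0 : (s : ℂ) ≠ 0 := by exact_mod_cast (hJ0 hs : 0 < s).ne'
    rw [eq_div_iff hs0, ← mul_monicr hμ (hJ0 hs) (H s hs), mul_comm]
  refine (h2.congr_of_eventuallyEq h3).congr_deriv ?_
  have h4 := mul_monicr hμ (hJ0 ht) (H t ht)
  -- The derivative r of the subleading coefficient cancels the -r coming from division by t.
  simp only [id, Complex.ofReal_one, ← h4, hasDerivAt_subleading hμ hJ hJ0 H ht hDd hD]
  field_simp
  ring

end Evolution
-- From orthonormal to monic polynomials.
section Normalization

variable {ζ μ t : ℝ} {α n : ℕ} {p : ℕ → ℂ[X]}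

/-- The monic multiples of the polynomials `p_k`. -/
noncomputable def monicMultiple (p : ℕ → ℂ[X]) (k : ℕ) : ℂ[X] := C (p k).leadingCoeff⁻¹ * p k

theorem IsOrthonormalSystem.leadingCoeff_ne_zero {w : ℝ → ℝ} (h : IsOrthonormalSystem w n p)
    {k : ℕ} (hk : k ≤ n) : (p k).leadingCoeff ≠ 0 := by
  rw [Ne, leadingCoeff_eq_zero]
  intro h0
  have := h.form_eq k hk k hk
  simp [form, h0] at this

theorem apply_monicMultiple_mul (L : ℂ[X] →ₗ[ℂ] ℂ) (p : ℕ → ℂ[X]) (i j : ℕ) :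
    L (monicMultiple p i * monicMultiple p j)
      = (p i).leadingCoeff⁻¹ * (p j).leadingCoeff⁻¹ * L (p i * p j) := by
  have e : monicMultiple p i * monicMultiple p j
      = ((p i).leadingCoeff⁻¹ * (p j).leadingCoeff⁻¹) • (p i * p j) := by
    rw [smul_eq_C_mul, C_mul, monicMultiple, monicMultiple]; ring
  rw [e, map_smul, smul_eq_mul]

theorem IsOrthonormalSystem.isMonicOrthogonal (hμ : -1 < μ) (ht : 0 < t)
    (h : IsOrthonormalSystem (weight ζ α μ t) n p) :
    IsMonicOrthogonal (weightFunctional ζ α μ t) n (monicMultiple p) where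
  monic k hk := by
    rw [Monic, monicMultiple, leadingCoeff_mul, leadingCoeff_C,
      inv_mul_cancel₀ (h.leadingCoeff_ne_zero hk)]
  natDegree_eq k hk := by
    rw [monicMultiple, natDegree_C_mul (inv_ne_zero (h.leadingCoeff_ne_zero hk)),
      h.natDegree_eq k hk]
  orthogonal i hi j hj := by
    rw [apply_monicMultiple_mul, ← form_eq_weightFunctional ζ hμ α ht,
      h.form_eq i hi j (by omega), if_neg (by omega), mul_zero]
  norm_ne_zero k hk := by
    rw [apply_monicMultiple_mul, ← form_eq_weightFunctional ζ hμ α ht,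
      h.form_eq k hk k hk, if_pos rfl, mul_one]
    have := inv_ne_zero (h.leadingCoeff_ne_zero hk)
    exact mul_ne_zero this this

theorem IsOrthonormalSystem.norm_monicMultiple (hμ : -1 < μ) (ht : 0 < t)
    (h : IsOrthonormalSystem (weight ζ α μ t) n p) {k : ℕ} (hk : k ≤ n) :
    weightFunctional ζ α μ t (monicMultiple p k * monicMultiple p k)
      = (p k).leadingCoeff⁻¹ ^ 2 := by
  rw [apply_monicMultiple_mul, ← form_eq_weightFunctional ζ hμ α ht,
    h.form_eq k hk k hk, if_pos rfl, mul_one, sq]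

theorem ladderR_eq_monicR (hμ : -1 < μ) (ht : 0 < t)
    (h : IsOrthonormalSystem (weight ζ (α + 1) μ t) n p) :
    ladderR ζ (α + 1) μ t p n = monicR ζ α μ t (monicMultiple p) n := by
  have h0 := h.leadingCoeff_ne_zero le_rfl
  have e : ∀ y : ℝ, (weight ζ (α + 1) μ t y : ℂ) * (p n).eval (y : ℂ) ^ 2 / ((y : ℂ) - (t : ℂ))
      = (weight ζ (α + 1) μ t y : ℂ) * (p n * p n).eval (y : ℂ) / ((y : ℂ) - (t : ℂ)) := by
    intro y; rw [eval_mul, sq]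
  rw [ladderR, monicR, h.norm_monicMultiple hμ ht le_rfl, apply_monicMultiple_mul]
  simp_rw [e]
  rw [integral_weight_div ζ hμ α ht]
  push_cast
  field_simp

/-- The factor a_n makes the expression independent of signs: a_n p_n p_{n-1} = γ_{n-1}² P_n
P_{n-1}, and γ_{n-1}² is the inverse norm of P_{n-1}. -/
theorem ladderr_eq_monicr (hμ : -1 < μ) (ht : 0 < t)
    (h : IsOrthonormalSystem (weight ζ (α + 1) μ t) n p) :
    ladderr ζ (α + 1) μ t p n = monicr ζ α μ t (monicMultiple p) n := by
  cases n with
  | zero => rfl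
  | succ n =>
    have h0 := h.leadingCoeff_ne_zero (k := n) (by omega)
    have h1 := h.leadingCoeff_ne_zero le_rfl
    have e : ∀ y : ℝ, (weight ζ (α + 1) μ t y : ℂ) * (p (n + 1)).eval (y : ℂ)
          * (p n).eval (y : ℂ) / ((y : ℂ) - (t : ℂ))
        = (weight ζ (α + 1) μ t y : ℂ) * (p (n + 1) * p n).eval (y : ℂ)
          / ((y : ℂ) - (t : ℂ)) := by
      intro y; rw [eval_mul]; ring
    rw [ladderr, monicr, h.norm_monicMultiple hμ ht (by omega), apply_monicMultiple_mul]
    simp_rw [e]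
    rw [integral_weight_div ζ hμ α ht, recA]
    push_cast
    field_simp

theorem recB_eq_monicB (hμ : -1 < μ) (ht : 0 < t)
    (h : IsOrthonormalSystem (weight ζ (α + 1) μ t) n p) {k : ℕ} (hk : k ≤ n) :
    recB (weight ζ (α + 1) μ t) p k = monicB ζ α μ t (monicMultiple p) k := by
  have h0 := h.leadingCoeff_ne_zero hk
  have e : monicMultiple p k * (X * monicMultiple p k)
      = ((p k).leadingCoeff⁻¹ ^ 2) • (X * p k * p k) := by
    rw [smul_eq_C_mul, C_pow, monicMultiple]; ring
  rw [recB, monicB, h.norm_monicMultiple hμ ht hk, e, map_smul,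
    form_eq_weightFunctional ζ hμ _ ht, smul_eq_mul, mul_div_cancel_left₀]
  exact pow_ne_zero _ (inv_ne_zero h0)

theorem ladderR_eq_isoTheta (hμ : -1 < μ) (ht : 0 < t)
    (h : IsOrthonormalSystem (weight ζ (α + 1) μ t) n p) :
    ladderR ζ (α + 1) μ t p n = (t + isoTheta ζ (α + 1) μ t p n) / t := by
  have ht0 : (t : ℂ) ≠ 0 := by exact_mod_cast ht.ne'
  rw [eq_div_iff ht0, mul_comm, ladderR_eq_monicR hμ ht h,
    mul_monicR hμ ht (h.isMonicOrthogonal hμ ht), isoTheta, recB_eq_monicB hμ ht h le_rfl]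
  push_cast
  ring

theorem ladderr_eq_isoKappa (hμ : -1 < μ) (ht : 0 < t)
    (h : IsOrthonormalSystem (weight ζ (α + 1) μ t) n p) :
    ladderr ζ (α + 1) μ t p n = isoKappa ζ (α + 1) μ t p n / t - (n + μ / 2) := by
  have ht0 : (t : ℂ) ≠ 0 := by exact_mod_cast ht.ne'
  suffices hs : t * ladderr ζ (α + 1) μ t p n = recA p n ^ 2
      - ∑ i ∈ Finset.range n, recB (weight ζ (α + 1) μ t) p i by
    rw [isoKappa, eq_sub_iff_add_eq, eq_div_iff ht0]
    linear_combination hs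
  rw [ladderr_eq_monicr hμ ht h]
  have H := h.isMonicOrthogonal hμ ht
  have hsum := H.nextCoeff_eq_neg_sum
  have hb : ∑ i ∈ Finset.range n, recB (weight ζ (α + 1) μ t) p i
      = -(monicMultiple p n).nextCoeff := by
    rw [hsum, neg_neg]
    refine Finset.sum_congr rfl fun i hi => ?_
    rw [recB_eq_monicB hμ ht h (Finset.mem_range.1 hi).le, monicB]
  rw [hb]
  cases n with
  | zero => simp [monicr, recA, nextCoeff, H.natDegree_eq 0 le_rfl]
  | succ n =>
    have h1 := h.leadingCoeff_ne_zero le_rfl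
    have h0 := h.leadingCoeff_ne_zero (k := n) (by omega)
    rw [mul_monicr hμ ht H, h.norm_monicMultiple hμ ht le_rfl,
      h.norm_monicMultiple hμ ht (by omega), nextCoeff, H.natDegree_eq _ le_rfl, recA]
    simp only [Nat.add_one_ne_zero, if_false, Nat.add_sub_cancel]
    field_simp
    ring

end Normalization

/-! ### Assembling the ladder system. -/

theorem ladderSystemAt_of_isOrthonormalSystem {ζ μ : ℝ} (hμ : -1 < μ) {α n : ℕ} {J : Set ℝ}
    {p : ℝ → ℕ → ℂ[X]} (hJ : IsOpen J) (hJ0 : J ⊆ Ioi 0)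
    (h : ∀ t ∈ J, IsOrthonormalSystem (weight ζ (α + 1) μ t) n (p t)) {t : ℝ} (ht : t ∈ J) :
    LadderSystemAt n (α + 1) μ (fun s => ladderR ζ (α + 1) μ s (p s) n)
      (fun s => ladderr ζ (α + 1) μ s (p s) n) t := by
  have ht0 : (t : ℂ) ≠ 0 := by exact_mod_cast (hJ0 ht : 0 < t).ne'
  have H : ∀ s ∈ J, IsMonicOrthogonal (weightFunctional ζ (α + 1) μ s) n (monicMultiple (p s)) :=
    fun s hs => (h s hs).isMonicOrthogonal hμ (hJ0 hs)
  have hR : (fun s => ladderR ζ (α + 1) μ s (p s) n) =ᶠ[𝓝 t]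
      fun s => monicR ζ α μ s (monicMultiple (p s)) n := by
    filter_upwards [hJ.mem_nhds ht] with s hs
    exact ladderR_eq_monicR hμ (hJ0 hs) (h s hs)
  have hr : (fun s => ladderr ζ (α + 1) μ s (p s) n) =ᶠ[𝓝 t]
      fun s => monicr ζ α μ s (monicMultiple (p s)) n := by
    filter_upwards [hJ.mem_nhds ht] with s hs
    exact ladderr_eq_monicr hμ (hJ0 hs) (h s hs)
  have dR := (hasDerivAt_monicR hμ hJ hJ0 H ht).congr_of_eventuallyEq hR
  have hRt := hR.self_of_nhds
  have hrt := hr.self_of_nhds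
  simp only at hRt hrt
  have eqR : (t : ℂ) * deriv (fun s => ladderR ζ (α + 1) μ s (p s) n) t
      = 2 * ladderr ζ (α + 1) μ t (p t) n - (α + 1 : ℕ) + ladderR ζ (α + 1) μ t (p t) n
        * (t * ladderR ζ (α + 1) μ t (p t) n + 2 * n + (α + 1 : ℕ) + μ - t) := by
    rw [dR.deriv, hRt, hrt, mul_div_cancel₀ _ ht0]
    push_cast
    ring
  cases n with
  | zero =>
    refine ⟨dR.differentiableAt, differentiableAt_const _, eqR, fun _ _ => ?_⟩
    simp [ladderr]
  | succ n =>
    have dr := (hasDerivAt_monicr hμ hJ hJ0 H ht).congr_of_eventuallyEq hr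
    refine ⟨dR.differentiableAt, dr.differentiableAt, eqR, fun h0 h1 => ?_⟩
    have k1 := monic_relation_at_jump (H t ht)
    have k2 := monic_relation_at_zero hμ (hJ0 ht) (H t ht)
    beta_reduce at h0 h1 ⊢
    rw [dr.deriv, mul_div_cancel₀ _ ht0]
    rw [hRt] at h0 h1 ⊢
    rw [hrt]
    have h1' : 1 - monicR ζ α μ t (monicMultiple (p t)) (n + 1) ≠ 0 := sub_ne_zero.2 (Ne.symm h1)
    have h1'' : monicR ζ α μ t (monicMultiple (p t)) (n + 1) - 1
      = -(1 - monicR ζ α μ t (monicMultiple (p t)) (n + 1)) := by ring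
    rw [h1'', div_neg]
    generalize weightFunctional ζ (α + 1) μ t
      (monicMultiple (p t) (n + 1) * monicMultiple (p t) (n + 1))
        / weightFunctional ζ (α + 1) μ t (monicMultiple (p t) n * monicMultiple (p t) n) = A at *
    generalize monicR ζ α μ t (monicMultiple (p t)) (n + 1) = R at *
    generalize monicR ζ α μ t (monicMultiple (p t)) n = S at *
    generalize monicr ζ α μ t (monicMultiple (p t)) (n + 1) = r at *
    push_cast
    field_simp
    -- Elimination of A and S: (1-R)²·ARS - R²·A(1-R)(1-S) = R(1-R)·A(S-R), and A(S-R) is t r'.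
    linear_combination -(1 - R) ^ 2 * k1 + R ^ 2 * k2

/-! ### Equivalence with the isomonodromy system. -/

section Substitution

variable {θ κ : ℝ → ℂ} {t : ℝ}

theorem hasDerivAt_ofReal_id (t : ℝ) : HasDerivAt (fun s : ℝ => (s : ℂ)) 1 t := by
  simpa using (hasDerivAt_id t).ofReal_comp

theorem differentiableAt_add_div_iff (ht : 0 < t) :
    DifferentiableAt ℝ (fun s : ℝ => ((s : ℂ) + θ s) / s) t ↔ DifferentiableAt ℝ θ t := by
  have ht0 : (t : ℂ) ≠ 0 := by exact_mod_cast ht.ne'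
  have hid := (hasDerivAt_ofReal_id t).differentiableAt
  refine ⟨fun h => ?_, fun h => (hid.fun_add h).fun_div hid ht0⟩
  refine ((h.fun_mul hid).fun_sub hid).congr_of_eventuallyEq ?_
  filter_upwards [lt_mem_nhds ht] with s hs
  have hs0 : (s : ℂ) ≠ 0 := by exact_mod_cast hs.ne'
  rw [div_mul_cancel₀ _ hs0]
  ring

theorem differentiableAt_div_sub_const_iff (ht : 0 < t) (c : ℂ) :
    DifferentiableAt ℝ (fun s : ℝ => κ s / s - c) t ↔ DifferentiableAt ℝ κ t := by
  have ht0 : (t : ℂ) ≠ 0 := by exact_mod_cast ht.ne'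
  have hid := (hasDerivAt_ofReal_id t).differentiableAt
  refine ⟨fun h => ?_, fun h => (h.fun_div hid ht0).sub_const c⟩
  refine ((h.add_const c).fun_mul hid).congr_of_eventuallyEq ?_
  filter_upwards [lt_mem_nhds ht] with s hs
  have hs0 : (s : ℂ) ≠ 0 := by exact_mod_cast hs.ne'
  rw [sub_add_cancel, div_mul_cancel₀ _ hs0]

theorem deriv_add_div (ht : 0 < t) (h : DifferentiableAt ℝ θ t) :
    (t : ℂ) * deriv (fun s : ℝ => ((s : ℂ) + θ s) / s) t = deriv θ t - θ t / t := by
  have ht0 : (t : ℂ) ≠ 0 := by exact_mod_cast ht.ne'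
  have hid := hasDerivAt_ofReal_id t
  rw [((hid.fun_add h.hasDerivAt).fun_div hid ht0).deriv]
  field_simp
  ring

theorem deriv_div_sub_const (ht : 0 < t) (c : ℂ) (h : DifferentiableAt ℝ κ t) :
    (t : ℂ) * deriv (fun s : ℝ => κ s / s - c) t = deriv κ t - κ t / t := by
  have ht0 : (t : ℂ) ≠ 0 := by exact_mod_cast ht.ne'
  have hid := hasDerivAt_ofReal_id t
  rw [((h.hasDerivAt.fun_div hid ht0).sub_const c).deriv]
  field_simp

theorem ladderSystemAt_iff_isomonodromySystemAt (n α : ℕ) (μ : ℝ) (ht : 0 < t) :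
    LadderSystemAt n α μ (fun s => ((s : ℂ) + θ s) / s)
      (fun s => κ s / s - ((n : ℂ) + (μ : ℂ) / 2)) t ↔ IsomonodromySystemAt n α μ θ κ t := by
  have ht0 : (t : ℂ) ≠ 0 := by exact_mod_cast ht.ne'
  have hfirst : DifferentiableAt ℝ θ t →
      (((t : ℂ) * deriv (fun s : ℝ => ((s : ℂ) + θ s) / s) t
        = 2 * (κ t / t - ((n : ℂ) + (μ : ℂ) / 2)) - α + ((t : ℂ) + θ t) / t
          * (t * (((t : ℂ) + θ t) / t) + 2 * n + α + μ - t)) ↔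
      (t : ℂ) * deriv θ t = 2 * κ t + (2 * n + α + 1 + μ + t + θ t) * θ t) := by
    intro h
    rw [deriv_add_div ht h]
    constructor
    · intro e
      have e := congrArg (fun z => (t : ℂ) * z) e
      field_simp at e
      linear_combination e
    · intro e
      field_simp
      linear_combination e
  have hsecond : DifferentiableAt ℝ κ t → θ t ≠ 0 → θ t + t ≠ 0 →
      (((t : ℂ) * deriv (fun s : ℝ => κ s / s - ((n : ℂ) + (μ : ℂ) / 2)) t =
      (1 - 2 * (((t : ℂ) + θ t) / t)) / (((t : ℂ) + θ t) / t * (1 - ((t : ℂ) + θ t) / t))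
          * (κ t / t - ((n : ℂ) + (μ : ℂ) / 2)) ^ 2
        - n * (n + μ) * (((t : ℂ) + θ t) / t / (1 - ((t : ℂ) + θ t) / t))
        + (2 * n + α + μ) * (κ t / t - ((n : ℂ) + (μ : ℂ) / 2))
        + (2 * n + μ) * (κ t / t - ((n : ℂ) + (μ : ℂ) / 2)) / (((t : ℂ) + θ t) / t - 1)
        - α * (κ t / t - ((n : ℂ) + (μ : ℂ) / 2)) / (((t : ℂ) + θ t) / t)) ↔
      (t : ℂ) * deriv κ t =
      (1 / (θ t + t) + 1 / θ t) * κ t ^ 2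
        + (2 * n + α + μ + 1 - (2 * n + α + μ) * (t / (θ t + t))) * κ t
        - (n ^ 2 + (n + μ / 2) * (α + μ)) * t - μ ^ 2 * t ^ 2 / (4 * θ t)
        + (n + μ / 2) * (n + α + μ / 2) * (t ^ 2 / (θ t + t))) := by
    intro h h0 h1
    rw [deriv_div_sub_const ht _ h]
    have e1 : ((t : ℂ) + θ t) / t - 1 = θ t / t := by field_simp; ring
    have e2 : 1 - ((t : ℂ) + θ t) / t = -(θ t / t) := by rw [← e1]; ring
    rw [e1, e2, add_comm (t : ℂ) (θ t)]
    -- The defects of the two equations differ by the factor t ≠ 0; the derivative of κ cancels and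
    -- a rational identity remains.
    have key : ∀ a b c d : ℂ, t * (b - c) = d - a → (c = b ↔ a = d) := by
      intro a b c d hh
      constructor
      · rintro rfl; linear_combination hh
      · rintro rfl
        rw [sub_self, mul_eq_zero, or_iff_right ht0] at hh
        exact (sub_eq_zero.1 hh).symm
    apply key
    field_simp
    ring
  have hne0 : ((t : ℂ) + θ t) / t ≠ 0 ↔ θ t + t ≠ 0 := by
    rw [div_ne_zero_iff, add_comm]; exact and_iff_left ht0
  have hne1 : ((t : ℂ) + θ t) / t ≠ 1 ↔ θ t ≠ 0 := by
    rw [Ne, div_eq_one_iff_eq ht0, add_eq_left]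
  constructor
  · rintro ⟨d1, d2, e1, e2⟩
    rw [differentiableAt_add_div_iff ht] at d1
    rw [differentiableAt_div_sub_const_iff ht] at d2
    exact ⟨d1, d2, (hfirst d1).1 e1, fun h0 h1 =>
      (hsecond d2 h0 h1).1 (e2 (hne0.2 h1) (hne1.2 h0))⟩
  · rintro ⟨d1, d2, e1, e2⟩
    exact ⟨(differentiableAt_add_div_iff ht).2 d1, (differentiableAt_div_sub_const_iff ht _).2 d2,
      (hfirst d1).2 e1, fun h0 h1 => (hsecond d2 (hne1.1 h1) (hne0.1 h0)).2
        (e2 (hne1.1 h1) (hne0.1 h0))⟩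

end Substitution
end LadderPV

theorem theorem3p8 (ζ μ : ℝ) (hμ : -1 < μ) (α : ℕ) (hα : 1 ≤ α) (n : ℕ) :
    -- the ladder-operator quantities satisfy the system and are related to `θ_n`, `κ_n`
    (∀ (J : Set ℝ) (p : ℝ → ℕ → Polynomial ℂ), IsOpen J → J ⊆ Set.Ioi 0 →
      (∀ t ∈ J, LadderPV.IsOrthonormalSystem (LadderPV.weight ζ α μ t) n (p t)) →
      ∀ t ∈ J,
        LadderPV.LadderSystemAt n α μ
          (fun s => LadderPV.ladderR ζ α μ s (p s) n)
          (fun s => LadderPV.ladderr ζ α μ s (p s) n) t ∧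
        LadderPV.ladderR ζ α μ t (p t) n
          = ((t : ℂ) + LadderPV.isoTheta ζ α μ t (p t) n) / t ∧
        LadderPV.ladderr ζ α μ t (p t) n
          = LadderPV.isoKappa ζ α μ t (p t) n / t - ((n : ℂ) + (μ : ℂ) / 2)) ∧
    -- under the substitution the two systems coincide
    (∀ (θ κ : ℝ → ℂ) (t : ℝ), 0 < t →
      (LadderPV.LadderSystemAt n α μ
          (fun s => ((s : ℂ) + θ s) / s)
          (fun s => κ s / s - ((n : ℂ) + (μ : ℂ) / 2)) t ↔
        LadderPV.IsomonodromySystemAt n α μ θ κ t)) := by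
  -- Division of the weight by x - t must leave a natural exponent.
  obtain ⟨a, rfl⟩ : ∃ a, α = a + 1 := ⟨α - 1, by omega⟩
  refine ⟨fun J p hJ hJ0 h t ht => ⟨?_, ?_, ?_⟩, fun θ κ t ht => ?_⟩
  · exact LadderPV.ladderSystemAt_of_isOrthonormalSystem hμ hJ hJ0 h ht
  · exact LadderPV.ladderR_eq_isoTheta hμ (hJ0 ht) (h t ht)
  · exact LadderPV.ladderr_eq_isoKappa hμ (hJ0 ht) (h t ht)
  · exact LadderPV.ladderSystemAt_iff_isomonodromySystemAt n (a + 1) μ ht
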